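/- Let $G$ be a finitely generated amenable group with a fixed finite symmetric generating set $S$. (Amenable means: for every finite $E\subset G$ and $\varepsilon>0$ there is a nonempty finite $F\subset G$ with $|gF\,\Delta\,F|\le\varepsilon|F|$ for all $g\in E$.) For a nonempty finite set $F\subset G$ put $\partial F=\{g\in F : sg\notin F\text{ for some }s\in S\}$, and for $n\ge 1$ put $$\mathcal I_G(n)=\inf\Big\{\tfrac{|\partial F|}{|F|} : \emptyset\ne F\subset G,\ |F|\le n\Big\}.$$ A multi-tile is a tuple $T=(T_1,\dots,T_N)$ of finite subsets of $G$ (the shapes), each containing the identity, for which there are sets $C_1,\dots,C_N\subset G$ such that the right translates $T_ic$ ($1\le i\le N$, $c\in C_i$) partition $G$. For an action of $G$ on a standard Borel space $X$ with a probability measure $\mu$, put for $n\ge 1$ $$\mathcal I_{G\curvearrowright X}(n)=\inf_{\theta}\ \mu\{x\in X : sx\notin[x]_\theta\text{ for some }s\in S\},$$ where $\theta$ runs over the equivalence relations on $X$ that are measurable subsets of $X\times X$, are contained in the orbit equivalence relation of $G$, and have all classes of size at most $n$. (1) If $G$ is infinite, there is a sequence $(T_n)_{n\ge1}$ of multi-tiles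 $T_n=(T_{1n},\dots,T_{Nn})$, $N=N(n)$, with $|T_{in}|\le n$ for all $n\ge 1$ and $1\le i\le N(n)$, and $\max_{1\le i\le N(n)}\frac{|\partial T_{in}|}{|T_{in}|}\to0$ as $n\to\infty$. (2) For every essentially free (in particular, for every free) probability measure preserving action of $G$ on a standard Borel probability space $(X,\mu)$, every $n\ge 1$ and every multi-tile $(T_1,\dots,T_N)$ with $|T_i|\le n$ for all $i$, $$\mathcal I_{G\curvearrowright X}(n)\le\max_{1\le i\le N}\frac{|\partial T_i|}{|T_i|}.$$ (3) Consequently, for every such action and every sequence $(T_n)_{n\ge1}$ of multi-tiles $T_n=(T_{1n},\dots,T_{N(n)n})$ with $|T_{in}|\le n$ for all $i$ and $n$: if $\max_{1\le i\le N(n)}\frac{|\partial T_{in}|}{|T_{in}|}$ is asymptotic to $\mathcal I_G(n)$ as $n\to\infty$, then $\mathcal I_{G\curvearrowright X}(n)$ is asymptotic to $\mathcal I_G(n)$. This holds both when $a_n$ asymptotic to $b_n$ means $a_n-b_n=o(b_n)$, and when it means that $a_n$ and $b_n$ agree up to positive multiplicative constants for all large $n$. -/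

import Mathlib

open Filter Topology MeasureTheory Asymptotics
open scoped Pointwise symmDiff

universe u v

noncomputable section

namespace IsoProfile

/-- A discrete group is amenable if it satisfies the Følner condition: for every finite set `E` and
every `ε > 0` there is a nonempty finite set `F` with `|gF ∆ F| ≤ ε |F|` for all `g ∈ E`. -/
def IsAmenableGroup (G : Type u) [Group G] : Prop :=
  ∀ (E : Finset G) (ε : ℝ), 0 < ε →
    ∃ F : Finset G, F.Nonempty ∧
      ∀ g ∈ E, (((g • (F : Set G)) ∆ (F : Set G)).ncard : ℝ) ≤ ε * (F.card : ℝ)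

/-- `S` is a finite symmetric generating set of `G`. -/
structure IsSymmGenSet {G : Type u} [Group G] (S : Finset G) : Prop where
  inv_mem : ∀ s ∈ S, s⁻¹ ∈ S
  closure_eq_top : Subgroup.closure (S : Set G) = ⊤

open Classical in
/-- The inner boundary `∂F = {g ∈ F | s g ∉ F for some s ∈ S}`. -/
def boundary {G : Type u} [Group G] (S F : Finset G) : Finset G :=
  F.filter (fun g => ∃ s ∈ S, s * g ∉ F)

/-- The boundary ratio `|∂F| / |F|` (used for nonempty `F` only). -/
def boundaryRatio {G : Type u} [Group G] (S F : Finset G) : ℝ :=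
  ((boundary S F).card : ℝ) / (F.card : ℝ)

/-- The isoperimetric profile of `(G, S)`: the infimum of `|∂F| / |F|` over the nonempty finite
sets `F` with at most `n` elements (meaningful for `n ≥ 1`). -/
def groupProfile {G : Type u} [Group G] (S : Finset G) (n : ℕ) : ℝ :=
  sInf {r : ℝ | ∃ F : Finset G, F.Nonempty ∧ F.card ≤ n ∧ r = boundaryRatio S F}

/-- A multi-tile: a finite tuple of finite sets (the shapes), each containing the identity, such
that for some sets of centers `C i` the right translates `shape i * c`, `c ∈ C i`, partition `G`:
every `g` lies in `shape i * c` for exactly one pair `(i, c)` with `c ∈ C i`. -/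
structure MultiTile (G : Type u) [Group G] where
  /-- the number of shapes -/
  N : ℕ
  /-- the shapes -/
  shape : Fin N → Finset G
  one_mem : ∀ i, (1 : G) ∈ shape i
  exists_centers : ∃ C : Fin N → Set G,
    ∀ g : G, ∃! p : Fin N × G, p.2 ∈ C p.1 ∧ ∃ t ∈ shape p.1, g = t * p.2

/-- The largest boundary ratio of a shape of the multi-tile. The index set is finite, and it is
nonempty because the translates of the shapes cover `G`. -/
def MultiTile.maxRatio {G : Type u} [Group G] (S : Finset G) (T : MultiTile G) : ℝ :=
  ⨆ i : Fin T.N, boundaryRatio S (T.shape i)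

/-- All shapes of the multi-tile have at most `n` elements. -/
def MultiTile.SizeLE {G : Type u} [Group G] (T : MultiTile G) (n : ℕ) : Prop :=
  ∀ i : Fin T.N, (T.shape i).card ≤ n

/-- `θ` is a measurable subequivalence relation of the orbit equivalence relation of `G ↷ X`
all of whose classes have at most `n` elements. -/
structure IsSubrelation (G : Type u) {X : Type v} [Group G] [MulAction G X] [MeasurableSpace X]
    (θ : Setoid X) (n : ℕ) : Prop where
  measurableSet : MeasurableSet {p : X × X | θ p.1 p.2}
  le_orbitRel : θ ≤ MulAction.orbitRel G X
  encard_le : ∀ x : X, {y : X | θ x y}.encard ≤ n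

/-- The boundary `∂θ = {x | s x ∉ [x]_θ for some s ∈ S}` of an equivalence relation. -/
def relBoundary {G : Type u} {X : Type v} [Group G] [MulAction G X] (S : Finset G)
    (θ : Setoid X) : Set X :=
  {x : X | ∃ s ∈ S, ¬ θ x (s • x)}

/-- The isoperimetric profile of the action `(G, S) ↷ (X, μ)`: the infimum of `μ(∂θ)` over the
measurable subequivalence relations `θ` of the orbit relation with classes of size at most `n`
(meaningful for `n ≥ 1`). -/
def actionProfile {G : Type u} {X : Type v} [Group G] [MulAction G X] [MeasurableSpace X]
    (S : Finset G) (μ : Measure X) (n : ℕ) : ℝ :=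
  sInf {r : ℝ | ∃ θ : Setoid X, IsSubrelation G θ n ∧ r = μ.real (relBoundary S θ)}

/-- `G` acts on `(X, μ)` by measure-preserving maps, and the action is essentially free: every
nontrivial element fixes almost no point. -/
structure IsEssFreePMP (G : Type u) {X : Type v} [Group G] [MulAction G X] [MeasurableSpace X]
    (μ : Measure X) : Prop where
  measurePreserving : ∀ g : G, MeasurePreserving (fun x : X => g • x) μ μ
  ess_free : ∀ g : G, g ≠ 1 → μ {x : X | g • x = x} = 0

end IsoProfile

end

/-! All three assertions rest on a quantitative form of the Ornstein–Weiss theorem that actions of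
amenable groups are hyperfinite. A label `γ : Z → G` with finitely many values sends `x` to its root
`γ(x)⁻¹x` and so cuts orbits into finite fibres `{tz | γ(tz) = t}`. For finite `K` and `ε > 0`,
`exists_label` gives a measurable label for which the points moved out of their fibre by some `k ∈
K` have mean at most `ε`, under all invariant means at once. It comes from greedily packing
translates of a Følner set: each round covers a fixed proportion of what is left and creates
boundary at most a small multiple of what it covers.

Upper bound: take `Z = X` with integration as the mean. Freeness identifies a fibre with a piece of
`G`, so the tiling of `G` can be copied into it. Whole tiles become classes and leftover points
singletons. The leftover lies near the boundary of the fibres, so its measure is at most `ε`, and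
each tile contributes at most its own boundary ratio (`actionProfile_le_maxRatio`).

Existence: take `Z = G`. The points in fibres with large boundary ratio have small mean, smaller
than that of a reserve of about `2η` of each good fibre. As this holds for all invariant means,
compactness yields a finite window whose right translates never contain more bad points than
reserved ones (`exists_window`). Hall's theorem matches bad points to reserved ones at bounded
distance (`exists_matching`), and attaching each bad point to the fibre of its match gives the
tiles.

Lower bound: the class of a free point is a finite set `F ⊆ G`, and mass transport shows that
`μ(∂θ)` is the integral of `|∂F| / |F|` (`groupProfile_le_measure_relBoundary`). Assertion (3) is
then a squeeze. -/

noncomputable section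

namespace IsoProfile

open scoped Classical

/-! ### Invariant means -/

section Mean

/-- The set of points with trivial stabilizer. -/
def freePart (G : Type u) [Group G] (Z : Type v) [MulAction G Z] : Set Z :=
  {x | ∀ g : G, g • x = x → g = 1}

/-- Bounded measurable real functions. -/
def IsBddMeas {Z : Type v} [MeasurableSpace Z] (f : Z → ℝ) : Prop :=
  Measurable f ∧ ∃ C, ∀ x, |f x| ≤ C

/-- An invariant mean on the bounded measurable functions on a `G`-space, for which the points with
nontrivial stabilizer are negligible. -/
structure InvMean (G : Type u) [Group G] (Z : Type v) [MulAction G Z] [MeasurableSpace Z] where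
  /-- the value of the mean at a function -/
  toFun : (Z → ℝ) → ℝ
  map_add : ∀ f h, IsBddMeas f → IsBddMeas h → toFun (fun x => f x + h x) = toFun f + toFun h
  map_mul : ∀ (a : ℝ) f, IsBddMeas f → toFun (fun x => a * f x) = a * toFun f
  mono : ∀ f h, IsBddMeas f → IsBddMeas h → (∀ x ∈ freePart G Z, f x ≤ h x) → toFun f ≤ toFun h
  map_one : toFun (fun _ => 1) = 1
  map_smul : ∀ (g : G) f, IsBddMeas f → toFun (fun x => f (g • x)) = toFun f

variable {G : Type u} [Group G] {Z : Type v} [MulAction G Z] [MeasurableSpace Z]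

namespace IsBddMeas

variable {f h : Z → ℝ}

lemma add (hf : IsBddMeas f) (hh : IsBddMeas h) : IsBddMeas (fun x => f x + h x) := by
  obtain ⟨hf, C, hC⟩ := hf
  obtain ⟨hh, D, hD⟩ := hh
  exact ⟨hf.add hh, C + D, fun x => (abs_add_le _ _).trans (add_le_add (hC x) (hD x))⟩

lemma const (a : ℝ) : IsBddMeas (fun _ : Z => a) := ⟨measurable_const, |a|, fun _ => le_rfl⟩

lemma const_mul (a : ℝ) (hf : IsBddMeas f) : IsBddMeas (fun x => a * f x) := by
  obtain ⟨hf, C, hC⟩ := hf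
  refine ⟨hf.const_mul a, |a| * C, fun x => ?_⟩
  rw [abs_mul]
  exact mul_le_mul_of_nonneg_left (hC x) (abs_nonneg a)

lemma sum {ι : Type*} (s : Finset ι) {f : ι → Z → ℝ} (hf : ∀ i ∈ s, IsBddMeas (f i)) :
    IsBddMeas (fun x => ∑ i ∈ s, f i x) := by
  induction s using Finset.induction_on with
  | empty => simpa using const 0
  | insert a s ha ih =>
    simp only [Finset.sum_insert ha]
    exact (hf a (by simp)).add (ih fun i hi => hf i (by simp [hi]))

lemma ite {A : Set Z} (hA : MeasurableSet A) (hf : IsBddMeas f) :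
    IsBddMeas (fun x => if x ∈ A then f x else 0) := by
  obtain ⟨hf, C, hC⟩ := hf
  refine ⟨Measurable.ite hA hf measurable_const, C, fun x => ?_⟩
  dsimp only
  split_ifs
  · exact hC x
  · simpa using (abs_nonneg _).trans (hC x)

lemma comp_smul [MeasurableConstSMul G Z] (hf : IsBddMeas f) (g : G) :
    IsBddMeas (fun x => f (g • x)) :=
  ⟨hf.1.comp (measurable_const_smul g), hf.2.imp fun _ hC _ => hC _⟩

lemma indicator {A : Set Z} (hA : MeasurableSet A) :
    IsBddMeas (fun x => if x ∈ A then (1 : ℝ) else 0) := (const 1).ite hA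

end IsBddMeas

namespace InvMean

variable (m : InvMean G Z)

/-- The value of an invariant mean at a set. -/
def set (A : Set Z) : ℝ := m.toFun (fun x => if x ∈ A then 1 else 0)

lemma map_zero : m.toFun (fun _ => 0) = 0 := by
  have := m.map_mul 0 (fun _ => 1) (.const 1)
  simpa using this

lemma map_sum {ι : Type*} (s : Finset ι) {f : ι → Z → ℝ} (hf : ∀ i ∈ s, IsBddMeas (f i)) :
    m.toFun (fun x => ∑ i ∈ s, f i x) = ∑ i ∈ s, m.toFun (f i) := by
  induction s using Finset.induction_on with
  | empty => simpa using m.map_zero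
  | insert a s ha ih =>
    simp only [Finset.sum_insert ha]
    have h := fun i (hi : i ∈ s) => hf i (by simp [hi])
    rw [m.map_add _ _ (hf a (by simp)) (.sum s h), ih h]

lemma map_const (a : ℝ) : m.toFun (fun _ => a) = a := by
  have := m.map_mul a (fun _ => 1) (.const 1)
  simpa [m.map_one] using this

lemma set_nonneg {A : Set Z} (hA : MeasurableSet A) : 0 ≤ m.set A := by
  rw [← m.map_zero]
  refine m.mono _ _ (.const 0) (.indicator hA) fun x _ => ?_
  split_ifs <;> norm_num

lemma set_mono {A B : Set Z} (hA : MeasurableSet A) (hB : MeasurableSet B)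
    (h : ∀ x ∈ freePart G Z, x ∈ A → x ∈ B) : m.set A ≤ m.set B := by
  refine m.mono _ _ (.indicator hA) (.indicator hB) fun x hx => ?_
  by_cases h1 : x ∈ A
  · simp [h1, h x hx h1]
  · rw [if_neg h1]
    split_ifs <;> norm_num

lemma set_univ : m.set Set.univ = 1 := by simpa [set] using m.map_one

lemma set_union_le {A B : Set Z} (hA : MeasurableSet A) (hB : MeasurableSet B) :
    m.set (A ∪ B) ≤ m.set A + m.set B := by
  unfold set
  rw [← m.map_add _ _ (.indicator hA) (.indicator hB)]
  refine m.mono _ _ (.indicator (hA.union hB)) ((IsBddMeas.indicator hA).add (.indicator hB))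
    fun x _ => ?_
  by_cases h1 : x ∈ A <;> by_cases h2 : x ∈ B <;> simp [h1, h2]

lemma set_biUnion_le {ι : Type*} (s : Finset ι) {A : ι → Set Z}
    (hA : ∀ i, MeasurableSet (A i)) :
    m.set (⋃ i ∈ s, A i) ≤ ∑ i ∈ s, m.set (A i) := by
  induction s using Finset.induction_on with
  | empty => simp [set, m.map_zero]
  | insert a s ha ih =>
    rw [Finset.sum_insert ha, Finset.set_biUnion_insert]
    refine (m.set_union_le (hA a) (s.measurableSet_biUnion fun i _ => hA i)).trans ?_
    gcongr

lemma set_add_of_disjoint {A B : Set Z} (hA : MeasurableSet A) (hB : MeasurableSet B)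
    (h : Disjoint A B) : m.set (A ∪ B) = m.set A + m.set B := by
  unfold set
  rw [← m.map_add _ _ (.indicator hA) (.indicator hB)]
  congr 1
  ext x
  by_cases h1 : x ∈ A
  · simp [h1, Set.disjoint_left.1 h h1]
  · by_cases h2 : x ∈ B <;> simp [h1, h2]

lemma set_diff {A B : Set Z} (hA : MeasurableSet A) (hB : MeasurableSet B) (h : B ⊆ A) :
    m.set (A \ B) = m.set A - m.set B := by
  have := m.set_add_of_disjoint hB (hA.diff hB) Set.disjoint_sdiff_right
  rw [Set.union_sdiff_cancel h] at this
  linarith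

lemma set_preimage_smul (g : G) {A : Set Z} (hA : MeasurableSet A) :
    m.set {x | g • x ∈ A} = m.set A :=
  m.map_smul g _ (.indicator hA)

variable [MeasurableConstSMul G Z]

lemma isBddMeas_card_filter (F : Finset G) {A : Set Z} (hA : MeasurableSet A) :
    IsBddMeas (fun z => ((F.filter fun t => t • z ∈ A).card : ℝ)) := by
  simp only [Finset.card_filter, Nat.cast_sum, Nat.cast_ite, Nat.cast_one, Nat.cast_zero]
  exact .sum F fun t _ => (IsBddMeas.indicator hA).comp_smul t

lemma map_card_filter (F : Finset G) {A : Set Z} (hA : MeasurableSet A) :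
    m.toFun (fun z => ((F.filter fun t => t • z ∈ A).card : ℝ)) = F.card * m.set A := by
  simp only [Finset.card_filter, Nat.cast_sum, Nat.cast_ite, Nat.cast_one, Nat.cast_zero]
  rw [m.map_sum F fun t _ => (IsBddMeas.indicator hA).comp_smul t,
    Finset.sum_congr rfl fun t _ => m.map_smul t _ (.indicator hA)]
  simp [set]

/-- Split `f` by the value `t` of the label and translate the piece of `t` by `t`; invariance
preserves the mean. At `z` the translated pieces add up to the sum of `f` over the fibre rooted at
`z`. -/
lemma map_eq_fiberwise {γ : Z → G} (hγ : ∀ g, MeasurableSet {x | γ x = g}) {F : Finset G}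
    (hF : ∀ x, γ x ∈ F) {f : Z → ℝ} (hf : IsBddMeas f) :
    IsBddMeas (fun z => ∑ t ∈ F with γ (t • z) = t, f (t • z)) ∧
    m.toFun (fun z => ∑ t ∈ F with γ (t • z) = t, f (t • z)) = m.toFun f := by
  have h1 : ∀ t, IsBddMeas (fun x => if x ∈ {x | γ x = t} then f x else 0) :=
    fun t => hf.ite (hγ t)
  have h2 : f = fun x => ∑ t ∈ F, if x ∈ {x | γ x = t} then f x else 0 := by
    ext x
    simp [hF x]
  simp only [Finset.sum_filter]
  refine ⟨.sum F fun t _ => (h1 t).comp_smul t, ?_⟩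
  conv_rhs => rw [h2]
  rw [m.map_sum F fun t _ => h1 t]
  refine (m.map_sum F fun t _ => (h1 t).comp_smul t).trans ?_
  exact Finset.sum_congr rfl fun t _ => m.map_smul t _ (h1 t)

/-- Mass transport: an inequality between fibrewise sums passes to the mean. -/
lemma le_of_fiberwise {γ : Z → G} (hγ : ∀ g, MeasurableSet {x | γ x = g}) {F : Finset G}
    (hF : ∀ x, γ x ∈ F) {f h : Z → ℝ} (hf : IsBddMeas f) (hh : IsBddMeas h)
    (H : ∀ z, ∑ t ∈ F with γ (t • z) = t, f (t • z) ≤ ∑ t ∈ F with γ (t • z) = t, h (t • z)) :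
    m.toFun f ≤ m.toFun h := by
  obtain ⟨h1, h2⟩ := m.map_eq_fiberwise hγ hF hf
  obtain ⟨h3, h4⟩ := m.map_eq_fiberwise hγ hF hh
  rw [← h2, ← h4]
  exact m.mono _ _ h1 h3 fun z _ => H z

end InvMean

/-- The root of a point labelled by `γ`. -/
def root (γ : Z → G) (x : Z) : Z := (γ x)⁻¹ • x

lemma measurable_root [MeasurableConstSMul G Z] {γ : Z → G}
    (hγ : ∀ g, MeasurableSet {x | γ x = g}) {F : Finset G} (hF : ∀ x, γ x ∈ F) :
    Measurable (root γ) := by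
  intro A hA
  have : root γ ⁻¹' A = ⋃ t ∈ F, {x | γ x = t} ∩ {x | t⁻¹ • x ∈ A} := by
    ext x
    simp [root, hF x]
  rw [this]
  exact F.measurableSet_biUnion fun t _ => (hγ t).inter (measurable_const_smul t⁻¹ hA)

end Mean

/-! ### Measurable finite subrelations with small boundary -/

section Stage

variable {G : Type u} [Group G] {Z : Type v} [MulAction G Z]

/-- The number of `t ∈ F` with `t • z ∈ A`. -/
def hits (F : Finset G) (A : Set Z) (z : Z) : ℝ := ((F.filter fun t => t • z ∈ A).card : ℝ)

lemma hits_mono {F F' : Finset G} {A A' : Set Z} (hF : F ⊆ F') (hA : A ⊆ A') (z : Z) :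
    hits F A z ≤ hits F' A' z := by
  unfold hits
  gcongr
  intro t
  simp only [Finset.mem_filter]
  exact fun h => ⟨hF h.1, hA h.2⟩

/-- The centers in `A` whose translates of `F` are almost interior in `Y` and almost disjoint from
the set `U` that is already covered. -/
def centers (K F : Finset G) (α : ℝ) (Y A U : Set Z) : Set Z :=
  {c ∈ A | hits (boundary K F) Y c ≤ α * hits F Y c ∧ hits F U c ≤ α * hits F Y c}

/-- The set covered after the first `n` steps of the greedy packing of `Y` by translates of `F`. -/
def covered (K F : Finset G) (α : ℝ) (Y : Set Z) (A : ℕ → Set Z) : ℕ → Set Z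
  | 0 => ∅
  | n + 1 => covered K F α Y A n ∪
      {x ∈ Y | ∃ f ∈ F, f⁻¹ • x ∈ centers K F α Y (A n) (covered K F α Y A n)}

/-- The points of `U` that the translation by `k` moves within `Y` out of their fibre. -/
def cut (U Y : Set Z) (γ : Z → G) (k : G) : Set Z :=
  {x ∈ U | k • x ∈ Y ∧ ¬ (k • x ∈ U ∧ root γ (k • x) = root γ x)}

lemma covered_mono (K F : Finset G) (α : ℝ) (Y : Set Z) (A : ℕ → Set Z) :
    Monotone (covered K F α Y A) :=
  monotone_nat_of_le_succ fun _ => Set.subset_union_left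

lemma covered_subset (K F : Finset G) (α : ℝ) (Y : Set Z) (A : ℕ → Set Z) (n : ℕ) :
    covered K F α Y A n ⊆ Y := by
  induction n with
  | zero => exact Set.empty_subset _
  | succ n ih => exact Set.union_subset ih fun x hx => hx.1

variable [MeasurableSpace Z]

/-- For free `c` and each of the finitely many `h = f'⁻¹f ≠ 1`, a set from a countable separating
family closed under complements contains `c` but not `hc`. Choices of one set per `h` are countable
in number, and each defines a piece. A clash `fc = f'c'` with `f ≠ f'` would put `c' = hc` both
inside and outside the set chosen for `h`. -/
lemma exists_measurable_cover [MeasurableConstSMul G Z] [MeasurableSpace.CountablySeparated Z]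
    (F : Finset G) :
    ∃ A : ℕ → Set Z, (∀ n, MeasurableSet (A n)) ∧
      (∀ n, ∀ c ∈ A n, ∀ c' ∈ A n, ∀ f ∈ F, ∀ f' ∈ F, f • c = f' • c' → f = f') ∧
      ∀ c ∈ freePart G Z, ∃ n, c ∈ A n := by
  obtain ⟨B, hB, hsep⟩ := exists_seq_separating Z (p := MeasurableSet) MeasurableSet.empty Set.univ
  let B' : ℕ × Bool → Set Z := fun p => if p.2 then B p.1 else (B p.1)ᶜ
  have hB' : ∀ p, MeasurableSet (B' p) := by
    rintro ⟨n, b⟩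
    cases b
    · simpa [B'] using hB n
    · simpa [B'] using hB n
  have hsep' : ∀ x y, x ≠ y → ∃ p, x ∈ B' p ∧ y ∉ B' p := by
    intro x y hxy
    by_contra! h
    refine hxy (hsep x trivial y trivial fun n => ⟨fun hx => ?_, fun hy => ?_⟩)
    · exact h (n, true) hx
    · by_contra hx
      exact h (n, false) hx hy
  let E : Finset G := ((F ×ˢ F).image fun p => p.2⁻¹ * p.1).erase 1
  obtain ⟨φ, hφ⟩ := exists_surjective_nat (E → ℕ × Bool)
  refine ⟨fun n => ⋂ h : E, B' (φ n h) ∩ {c | (h : G) • c ∉ B' (φ n h)}, fun n => ?_, ?_, ?_⟩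
  · exact MeasurableSet.iInter fun h => (hB' _).inter
      (measurable_const_smul (h : G) (hB' _).compl)
  · intro n c hc c' hc' f hf f' hf' hff
    by_contra hne
    have hE : f'⁻¹ * f ∈ E := by
      refine Finset.mem_erase.2 ⟨fun h => hne (inv_mul_eq_one.1 h).symm, ?_⟩
      exact Finset.mem_image.2 ⟨(f, f'), by simp [hf, hf'], rfl⟩
    have h1 := (Set.mem_iInter.1 hc ⟨_, hE⟩).2
    have h2 := (Set.mem_iInter.1 hc' ⟨_, hE⟩).1
    apply h1
    have : (f'⁻¹ * f) • c = c' := by rw [mul_smul, hff, inv_smul_smul]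
    simpa [this] using h2
  · intro c hc
    have : ∀ h : E, ∃ p, c ∈ B' p ∧ (h : G) • c ∉ B' p := by
      intro h
      refine hsep' _ _ fun hh => ?_
      exact (Finset.mem_erase.1 h.2).1 (hc _ hh.symm)
    choose ψ hψ using this
    obtain ⟨n, hn⟩ := hφ ψ
    refine ⟨n, Set.mem_iInter.2 fun h => ?_⟩
    rw [hn]
    exact hψ h

lemma measurable_hits [MeasurableConstSMul G Z] (F : Finset G) {A : Set Z}
    (hA : MeasurableSet A) : Measurable (hits F A) :=
  (InvMean.isBddMeas_card_filter F hA).1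

lemma measurableSet_centers [MeasurableConstSMul G Z] (K F : Finset G) (α : ℝ) {Y A U : Set Z}
    (hY : MeasurableSet Y) (hA : MeasurableSet A) (hU : MeasurableSet U) :
    MeasurableSet (centers K F α Y A U) :=
  hA.inter ((measurableSet_le (measurable_hits _ hY) ((measurable_hits _ hY).const_mul α)).inter
    (measurableSet_le (measurable_hits _ hU) ((measurable_hits _ hY).const_mul α)))

lemma measurableSet_covered [MeasurableConstSMul G Z] (K F : Finset G) (α : ℝ) {Y : Set Z}
    {A : ℕ → Set Z} (hY : MeasurableSet Y) (hA : ∀ n, MeasurableSet (A n)) (n : ℕ) :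
    MeasurableSet (covered K F α Y A n) := by
  induction n with
  | zero => exact MeasurableSet.empty
  | succ n ih =>
    refine ih.union (hY.inter (?_ : MeasurableSet
      {x : Z | ∃ f ∈ F, f⁻¹ • x ∈ centers K F α Y (A n) (covered K F α Y A n)}))
    have : {x : Z | ∃ f ∈ F, f⁻¹ • x ∈ centers K F α Y (A n) (covered K F α Y A n)} =
        ⋃ f ∈ F, {x | f⁻¹ • x ∈ centers K F α Y (A n) (covered K F α Y A n)} := by
      ext x
      simp
    rw [this]
    exact F.measurableSet_biUnion fun f _ =>
      measurable_const_smul f⁻¹ (measurableSet_centers K F α hY (hA n) ih)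

set_option maxHeartbeats 800000 in
/-- One round of packing: translates of `F` cover a definite proportion of `Y` by disjoint fibres
whose boundary inside `Y` is small. -/
lemma exists_packing [MeasurableConstSMul G Z] [MeasurableSpace.CountablySeparated Z]
    (K : Finset G) {F : Finset G} (hF : F.Nonempty) {α : ℝ} (hα : 0 < α) (hα' : α ≤ 1 / 2)
    {Y : Set Z} (hY : MeasurableSet Y) :
    ∃ (U : Set Z) (γ : Z → G), U ⊆ Y ∧ MeasurableSet U ∧ (∀ g, MeasurableSet {x | γ x = g}) ∧
      (∀ x, γ x ∈ F) ∧
      (∀ c ∈ freePart G Z, α * hits F Y c ≤ hits F U c + hits (boundary K F) Y c) ∧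
      ∀ z, ∀ k ∈ K, ∑ t ∈ F with γ (t • z) = t, (if t • z ∈ cut U Y γ k then (1 : ℝ) else 0) ≤
        ∑ t ∈ F with γ (t • z) = t, 4 * α * (if t • z ∈ U then (1 : ℝ) else 0) := by
  obtain ⟨A, hA, hdisj, hcov⟩ := exists_measurable_cover (Z := Z) F
  obtain ⟨f₀, hf₀⟩ := hF
  set V := covered K F α Y A with hV
  set C : ℕ → Set Z := fun n => centers K F α Y (A n) (V n) with hC
  have hVm : ∀ n, MeasurableSet (V n) := measurableSet_covered K F α hY hA
  have hCm : ∀ n, MeasurableSet (C n) := fun n => measurableSet_centers K F α hY (hA n) (hVm n)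
  have hVmono : Monotone V := covered_mono K F α Y A
  have hVsucc : ∀ n, V (n + 1) = V n ∪ {x ∈ Y | ∃ f ∈ F, f⁻¹ • x ∈ C n} := fun n => rfl
  -- `Q f` collects the points first covered by a center that reaches them through `f`. The stage is
  -- determined by the point, and translates of centers of one stage are disjoint, so `f` is unique.
  let Q : G → Set Z := fun f => ⋃ n, {x | (x ∈ Y ∧ x ∉ V n) ∧ f ∈ F ∧ f⁻¹ • x ∈ C n}
  have hQm : ∀ f, MeasurableSet (Q f) := fun f => MeasurableSet.iUnion fun n =>
    (hY.inter (hVm n).compl).inter ((MeasurableSet.const _).inter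
      (measurable_const_smul f⁻¹ (hCm n)))
  have hQV : ∀ {x f n}, x ∈ Y → x ∉ V n → f ∈ F → f⁻¹ • x ∈ C n → x ∈ V (n + 1) := by
    intro x f n h1 _ h3 h4
    rw [hVsucc]
    exact Or.inr ⟨h1, f, h3, h4⟩
  have hQuniq : ∀ x f f', x ∈ Q f → x ∈ Q f' → f = f' := by
    intro x f f' hx hx'
    obtain ⟨n, ⟨h1, h2⟩, h3, h4⟩ := Set.mem_iUnion.1 hx
    obtain ⟨n', ⟨h1', h2'⟩, h3', h4'⟩ := Set.mem_iUnion.1 hx'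
    have e : n = n' := by
      rcases lt_trichotomy n n' with h | h | h
      · exact absurd (hVmono h (hQV h1 h2 h3 h4)) h2'
      · exact h
      · exact absurd (hVmono h (hQV h1' h2' h3' h4')) h2
    subst e
    exact hdisj n _ h4.1 _ h4'.1 f h3 f' h3' (by simp)
  set U : Set Z := ⋃ n, V n with hU
  have hUQ : ∀ x, x ∈ U ↔ ∃ f, x ∈ Q f := by
    intro x
    constructor
    · intro hx
      have hx := Set.mem_iUnion.1 hx
      have h1 := Nat.find_spec hx
      obtain ⟨n, hn⟩ : ∃ n, Nat.find hx = n + 1 := by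
        refine Nat.exists_eq_succ_of_ne_zero fun h0 => ?_
        rw [h0] at h1
        exact h1
      have h2 : x ∉ V n := Nat.find_min hx (by omega)
      rw [hn, hVsucc] at h1
      obtain ⟨h3, f, h4, h5⟩ := h1.resolve_left h2
      exact ⟨f, Set.mem_iUnion.2 ⟨n, ⟨h3, h2⟩, h4, h5⟩⟩
    · rintro ⟨f, hf⟩
      obtain ⟨n, ⟨h1, h2⟩, h3, h4⟩ := Set.mem_iUnion.1 hf
      exact Set.mem_iUnion.2 ⟨n + 1, hQV h1 h2 h3 h4⟩
  let γ : Z → G := fun x => if h : ∃ f, x ∈ Q f then h.choose else f₀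
  have hγQ : ∀ {x f}, x ∈ Q f → γ x = f := by
    intro x f hx
    have h : ∃ f, x ∈ Q f := ⟨f, hx⟩
    simp only [γ, dif_pos h]
    exact hQuniq x _ _ h.choose_spec hx
  have hγU : ∀ {x}, x ∈ U → x ∈ Q (γ x) := by
    intro x hx
    obtain ⟨f, hf⟩ := (hUQ x).1 hx
    rwa [hγQ hf]
  have hγn : ∀ {x}, x ∉ U → γ x = f₀ := by
    intro x hx
    rw [hUQ] at hx
    simp only [γ, dif_neg hx]
  have hUm : MeasurableSet U := MeasurableSet.iUnion hVm
  have hQF : ∀ {x f}, x ∈ Q f → f ∈ F := by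
    intro x f hx
    obtain ⟨n, -, h3, -⟩ := Set.mem_iUnion.1 hx
    exact h3
  have hUY : U ⊆ Y := Set.iUnion_subset fun n => covered_subset K F α Y A n
  refine ⟨U, γ, hUY, hUm, fun g => ?_, fun x => ?_, fun c hc => ?_, fun z k hk => ?_⟩
  · have : {x | γ x = g} = Q g ∪ (Uᶜ ∩ {_x | g = f₀}) := by
      ext x
      by_cases hx : x ∈ U
      · simp only [Set.mem_ofPred_eq, Set.mem_union, Set.mem_inter_iff, Set.mem_compl_iff, hx,
          not_true_eq_false, false_and, or_false]
        exact ⟨fun h => h ▸ hγU hx, hγQ⟩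
      · have hx' : x ∉ Q g := fun h => hx ((hUQ x).2 ⟨g, h⟩)
        simp [hx, hx', hγn hx, eq_comm]
    rw [this]
    exact (hQm g).union (hUm.compl.inter (MeasurableSet.const _))
  · by_cases hx : x ∈ U
    · exact hQF (hγU hx)
    · rwa [hγn hx]
  -- At its stage a free point either becomes a center, and then all of `Fc ∩ Y` gets covered, or it
  -- fails one of the two tests, and that failure is already the inequality.
  · obtain ⟨n, hn⟩ := hcov c hc
    have hw : 0 ≤ hits F Y c := Nat.cast_nonneg _
    have hu : 0 ≤ hits F U c := Nat.cast_nonneg _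
    have hb : 0 ≤ hits (boundary K F) Y c := Nat.cast_nonneg _
    by_cases h1 : hits (boundary K F) Y c ≤ α * hits F Y c
    · by_cases h2 : hits F (V n) c ≤ α * hits F Y c
      · have h3 : c ∈ C n := ⟨hn, h1, h2⟩
        have h4 : hits F Y c ≤ hits F U c := by
          unfold hits
          gcongr 2
          intro t ht
          simp only [Finset.mem_filter] at ht ⊢
          refine ⟨ht.1, Set.mem_iUnion.2 ⟨n + 1, ?_⟩⟩
          rw [hVsucc]
          exact Or.inr ⟨ht.2, t, ht.1, by simpa using h3⟩
        nlinarith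
      · have := hits_mono (Finset.Subset.refl F) (Set.subset_iUnion V n) c
        linarith
    · linarith
  · rw [← Finset.mul_sum, Finset.sum_boole, Finset.sum_boole, Finset.filter_filter,
      Finset.filter_filter]
    by_cases hz : ∃ n, z ∈ C n
    swap
    · have : F.filter (fun t => γ (t • z) = t ∧ t • z ∈ cut U Y γ k) = ∅ := by
        refine Finset.filter_eq_empty_iff.2 fun t ht h => hz ?_
        have h1 := hγU h.2.1
        rw [h.1] at h1
        obtain ⟨n, -, -, h4⟩ := Set.mem_iUnion.1 h1
        exact ⟨n, by simpa using h4⟩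
      rw [this]
      simp only [Finset.card_empty, Nat.cast_zero]
      positivity
    -- Only the first stage at which `z` is a center matters, since after it all of `Fz ∩ Y` is
    -- covered. The fibre of `z` in `U` is therefore `Fz ∩ Y` without `V n`.
    · set n := Nat.find hz with hn
      have hzn : z ∈ C n := Nat.find_spec hz
      have key : ∀ t ∈ F, (γ (t • z) = t ∧ t • z ∈ U ↔ t • z ∈ Y ∧ t • z ∉ V n) := by
        intro t ht
        constructor
        · rintro ⟨h1, h2⟩
          have h3 := hγU h2
          rw [h1] at h3
          obtain ⟨n', ⟨h4, h5⟩, -, h6⟩ := Set.mem_iUnion.1 h3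
          have h7 : n ≤ n' := Nat.find_min' hz (by simpa using h6)
          exact ⟨h4, fun h => h5 (hVmono h7 h)⟩
        · rintro ⟨h1, h2⟩
          have : t • z ∈ Q t := Set.mem_iUnion.2 ⟨n, ⟨h1, h2⟩, ht, by simpa using hzn⟩
          exact ⟨hγQ this, (hUQ _).2 ⟨t, this⟩⟩
      -- A cut point comes from the boundary of `F`, or `k` carries it into `V n`. Each case
      -- accounts for at most `α * hits F Y z` points, and the fibre has at least half of `hits F Y
      -- z`; hence the constant `4 * α`.
      have hsub : F.filter (fun t => γ (t • z) = t ∧ t • z ∈ cut U Y γ k) ⊆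
          (boundary K F).filter (fun t => t • z ∈ Y) ∪
          (F.filter (fun t => t • z ∈ V n)).image (fun t => k⁻¹ * t) := by
        intro t ht
        obtain ⟨htF, ht1, ht2, ht3, ht4⟩ := Finset.mem_filter.1 ht
        by_cases hkt : k * t ∈ F
        · refine Finset.mem_union_right _ (Finset.mem_image.2 ⟨k * t, ?_, by group⟩)
          refine Finset.mem_filter.2 ⟨hkt, ?_⟩
          by_contra hcon
          rw [← mul_smul] at ht3 ht4
          obtain ⟨h5, h6⟩ := (key _ hkt).2 ⟨ht3, hcon⟩
          refine ht4 ⟨h6, ?_⟩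
          simp only [root, h5, ht1, inv_smul_smul]
        · exact Finset.mem_union_left _ (Finset.mem_filter.2
            ⟨Finset.mem_filter.2 ⟨htF, k, hk, hkt⟩, hUY ht2⟩)
      have h1 : ((F.filter (fun t => γ (t • z) = t ∧ t • z ∈ cut U Y γ k)).card : ℝ) ≤
          hits (boundary K F) Y z + hits F (V n) z := by
        unfold hits
        exact_mod_cast (Finset.card_le_card hsub).trans ((Finset.card_union_le _ _).trans
          (Nat.add_le_add_left Finset.card_image_le _))
      have h2 : hits F Y z ≤
          ((F.filter (fun t => γ (t • z) = t ∧ t • z ∈ U)).card : ℝ) + hits F (V n) z := by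
        unfold hits
        rw [← Nat.cast_add]
        refine Nat.cast_le.2 ((Finset.card_le_card ?_).trans (Finset.card_union_le _ _))
        intro t ht
        obtain ⟨h3, h4⟩ := Finset.mem_filter.1 ht
        by_cases h5 : t • z ∈ V n
        · exact Finset.mem_union_right _ (Finset.mem_filter.2 ⟨h3, h5⟩)
        · exact Finset.mem_union_left _ (Finset.mem_filter.2 ⟨h3, (key t h3).2 ⟨h4, h5⟩⟩)
      have h3 := hzn.2.1
      have h4 := hzn.2.2
      have hw : 0 ≤ hits F Y z := Nat.cast_nonneg _
      have h5 : hits F Y z ≤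
          2 * ((F.filter (fun t => γ (t • z) = t ∧ t • z ∈ U)).card : ℝ) := by nlinarith
      nlinarith

end Stage

/-! ### Labels with small boundary by iterated packing -/

section Hyperfinite

variable {G : Type u} [Group G]

lemma IsAmenableGroup.exists_boundary_le (hG : IsAmenableGroup G) (K : Finset G) {ε : ℝ}
    (hε : 0 < ε) :
    ∃ F : Finset G, F.Nonempty ∧ ((boundary K F).card : ℝ) ≤ ε * F.card := by
  obtain ⟨F, hF, h⟩ := hG K (ε / (K.card + 1)) (by positivity)
  refine ⟨F, hF, ?_⟩
  have h1 : boundary K F ⊆ K.biUnion fun k => F.filter fun f => k * f ∉ F := by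
    intro f hf
    obtain ⟨h1, k, hk, h2⟩ := Finset.mem_filter.1 hf
    exact Finset.mem_biUnion.2 ⟨k, hk, Finset.mem_filter.2 ⟨h1, h2⟩⟩
  have h2 : ∀ k ∈ K, ((F.filter fun f => k * f ∉ F).card : ℝ) ≤ ε / (K.card + 1) * F.card := by
    intro k hk
    refine le_trans (Nat.cast_le.2 ?_) (h k hk)
    have h3 : ((F.filter fun f => k * f ∉ F).image (fun f => k * f)).card =
        (F.filter fun f => k * f ∉ F).card :=
      Finset.card_image_of_injective _ (mul_right_injective k)
    rw [← h3, ← Set.ncard_coe_finset]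
    refine Set.ncard_le_ncard ?_ ?_
    · intro x hx
      simp only [Finset.coe_image, Finset.coe_filter, Set.mem_image] at hx
      obtain ⟨f, ⟨hf, hf'⟩, rfl⟩ := hx
      exact Or.inl ⟨⟨f, hf, rfl⟩, hf'⟩
    · exact ((F.finite_toSet.smul_set).symmDiff F.finite_toSet)
  calc ((boundary K F).card : ℝ) ≤ ∑ k ∈ K, ((F.filter fun f => k * f ∉ F).card : ℝ) := by
        exact_mod_cast (Finset.card_le_card h1).trans Finset.card_biUnion_le
    _ ≤ ∑ _k ∈ K, ε / (K.card + 1) * F.card := Finset.sum_le_sum h2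
    _ = (K.card / (K.card + 1)) * (ε * F.card) := by
        rw [Finset.sum_const, nsmul_eq_mul]
        ring
    _ ≤ 1 * (ε * F.card) := by
        gcongr
        rw [div_le_one (by positivity)]
        linarith
    _ = ε * F.card := one_mul _

variable {Z : Type v} [MulAction G Z]

/-- The pairs `(x, k • x)` that are separated by the fibres of the label `γ` on the complement
of `Y`, where pairs inside `Y` are left undecided. -/
def separated (Y : Set Z) (γ : Z → G) (k : G) : Set Z :=
  {x | ¬ (x ∈ Y ∧ k • x ∈ Y) ∧ ¬ (x ∉ Y ∧ k • x ∉ Y ∧ root γ (k • x) = root γ x)}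

/-- A newly decided pair `(x, kx)` had both ends in `Y` and now has one in `U`. If it is separated,
then `k` cuts it at `x ∈ U` or `k⁻¹` cuts it at `kx ∈ U`; this is why `exists_partial_label` wants
`K` symmetric. -/
lemma separated_diff_subset {Y U : Set Z} (hU : U ⊆ Y) (γ γ' : Z → G) (k : G) :
    separated (Y \ U) (fun x => if x ∈ U then γ' x else γ x) k ⊆
      separated Y γ k ∪ (cut U Y γ' k ∪ {x | k • x ∈ cut U Y γ' k⁻¹}) := by
  rintro x ⟨h1, h2⟩
  by_contra hcon
  simp only [Set.mem_union, not_or] at hcon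
  obtain ⟨hE, hc1, hc2⟩ := hcon
  have hr : ∀ y ∈ U, root (fun x => if x ∈ U then γ' x else γ x) y = root γ' y := by
    intro y hy
    simp [root, hy]
  have hr' : ∀ y ∉ U, root (fun x => if x ∈ U then γ' x else γ x) y = root γ y := by
    intro y hy
    simp [root, hy]
  by_cases hx : x ∈ Y
  · by_cases hkx : k • x ∈ Y
    · by_cases hxU : x ∈ U
      · by_cases hkU : k • x ∈ U
        · apply hc1
          refine ⟨hxU, hkx, fun h => h2 ⟨fun h' => h'.2 hxU, fun h' => h'.2 hkU, ?_⟩⟩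
          rw [hr _ hxU, hr _ hkU]
          exact h.2
        · exact hc1 ⟨hxU, hkx, fun h => hkU h.1⟩
      · by_cases hkU : k • x ∈ U
        · refine hc2 ⟨hkU, by simpa using hx, fun h => hxU (by simpa using h.1)⟩
        · exact h1 ⟨⟨hx, hxU⟩, hkx, hkU⟩
    · exact hE ⟨fun h => hkx h.2, fun h => h.1 hx⟩
  · by_cases hkx : k • x ∈ Y
    · exact hE ⟨fun h => hx h.1, fun h => h.2.1 hkx⟩
    · refine hE ⟨fun h => hx h.1, fun h => h2 ⟨fun h' => hx h'.1, fun h' => hkx h'.1, ?_⟩⟩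
      rw [hr' _ fun h' => hx (hU h'), hr' _ fun h' => hkx (hU h')]
      exact h.2.2

variable [MeasurableSpace Z] [MeasurableConstSMul G Z] [StandardBorelSpace Z]

lemma measurableSet_root_eq {γ : Z → G} (hγ : ∀ g, MeasurableSet {x | γ x = g}) {F : Finset G}
    (hF : ∀ x, γ x ∈ F) (k : G) : MeasurableSet {x | root γ (k • x) = root γ x} :=
  measurableSet_eq_fun ((measurable_root hγ hF).comp (measurable_const_smul k))
    (measurable_root hγ hF)

lemma measurableSet_cut {γ : Z → G} (hγ : ∀ g, MeasurableSet {x | γ x = g}) {F : Finset G}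
    (hF : ∀ x, γ x ∈ F) (k : G) {U Y : Set Z} (hU : MeasurableSet U) (hY : MeasurableSet Y) :
    MeasurableSet (cut U Y γ k) :=
  hU.inter ((measurable_const_smul k hY).inter
    ((measurable_const_smul k hU).inter (measurableSet_root_eq hγ hF k)).compl)

lemma measurableSet_separated {γ : Z → G} (hγ : ∀ g, MeasurableSet {x | γ x = g}) {F : Finset G}
    (hF : ∀ x, γ x ∈ F) (k : G) {Y : Set Z} (hY : MeasurableSet Y) :
    MeasurableSet (separated Y γ k) :=
  (hY.inter (measurable_const_smul k hY)).compl.inter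
    (hY.compl.inter ((measurable_const_smul k hY.compl).inter
      (measurableSet_root_eq hγ hF k))).compl

/-- One round of packing, seen by the invariant means. -/
lemma exists_packing_mean (hG : IsAmenableGroup G) (K : Finset G) {α : ℝ} (hα : 0 < α)
    (hα' : α ≤ 1 / 2) {Y : Set Z} (hY : MeasurableSet Y) :
    ∃ (U : Set Z) (γ : Z → G) (F : Finset G), U ⊆ Y ∧ MeasurableSet U ∧
      (∀ g, MeasurableSet {x | γ x = g}) ∧ (∀ x, γ x ∈ F) ∧
      ∀ m : InvMean G Z, α / 2 * m.set Y ≤ m.set U ∧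
        ∀ k ∈ K, m.set (cut U Y γ k) ≤ 4 * α * m.set U := by
  obtain ⟨F, hF, hFb⟩ := hG.exists_boundary_le K (half_pos hα)
  obtain ⟨U, γ, hUY, hU, hγ, hγF, hcov, hcut⟩ := exists_packing K hF hα hα' hY
  refine ⟨U, γ, F, hUY, hU, hγ, hγF, fun m => ⟨?_, fun k hk => ?_⟩⟩
  · have h1 := m.mono _ _ ((InvMean.isBddMeas_card_filter F hY).const_mul α)
      ((InvMean.isBddMeas_card_filter F hU).add
        (InvMean.isBddMeas_card_filter (boundary K F) hY)) hcov
    rw [m.map_mul _ _ (InvMean.isBddMeas_card_filter F hY), m.map_add _ _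
      (InvMean.isBddMeas_card_filter F hU) (InvMean.isBddMeas_card_filter (boundary K F) hY),
      m.map_card_filter F hY, m.map_card_filter F hU, m.map_card_filter _ hY] at h1
    have hF0 : (0 : ℝ) < F.card := by exact_mod_cast hF.card_pos
    have h2 := mul_le_mul_of_nonneg_right hFb (m.set_nonneg hY)
    have h3 : (F.card : ℝ) * (α / 2 * m.set Y) ≤ F.card * m.set U := by linarith
    exact le_of_mul_le_mul_left h3 hF0
  · have h1 := m.le_of_fiberwise hγ hγF (.indicator (measurableSet_cut hγ hγF k hU hY))
      ((IsBddMeas.indicator hU).const_mul (4 * α)) (fun z => hcut z k hk)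
    rwa [m.map_mul _ _ (.indicator hU)] at h1

/-- Packing is iterated on the uncovered set `Y`. A round removes at least the proportion `α / 2` of
`Y`, whence the geometric decay, and separates pairs of mean at most `2 · 4α` times that of the
newly covered set; these bounds telescope. -/
lemma exists_partial_label (hG : IsAmenableGroup G) {K : Finset G} (hK : ∀ k ∈ K, k⁻¹ ∈ K) {α : ℝ}
    (hα : 0 < α) (hα' : α ≤ 1 / 2) (j : ℕ) :
    ∃ (Y : Set Z) (γ : Z → G) (F : Finset G), MeasurableSet Y ∧
      (∀ g, MeasurableSet {x | γ x = g}) ∧ (∀ x, γ x ∈ F) ∧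
      ∀ m : InvMean G Z, m.set Y ≤ (1 - α / 2) ^ j ∧
        ∀ k ∈ K, m.set (separated Y γ k) ≤ 8 * α * (1 - m.set Y) := by
  induction j with
  | zero =>
    refine ⟨Set.univ, fun _ => 1, {1}, .univ, fun g => MeasurableSet.const _, fun _ => by simp,
      fun m => ⟨by simp [m.set_univ], fun k _ => ?_⟩⟩
    have : separated (Set.univ : Set Z) (fun _ => (1 : G)) k = ∅ := by
      ext x
      simp [separated]
    rw [this, m.set_univ]
    simp [InvMean.set, m.map_zero]
  | succ j ih =>
    obtain ⟨Y, γ, F, hY, hγ, hγF, hm⟩ := ih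
    obtain ⟨U, γ', F', hUY, hU, hγ', hγF', hm'⟩ :=
      exists_packing_mean hG K hα hα' hY
    have hγ'' : ∀ g, MeasurableSet {x | (if x ∈ U then γ' x else γ x) = g} := by
      intro g
      have : {x | (if x ∈ U then γ' x else γ x) = g} =
          (U ∩ {x | γ' x = g}) ∪ (Uᶜ ∩ {x | γ x = g}) := by
        ext x
        by_cases hx : x ∈ U <;> simp [hx]
      rw [this]
      exact (hU.inter (hγ' g)).union (hU.compl.inter (hγ g))
    have hF'' : ∀ x, (if x ∈ U then γ' x else γ x) ∈ F' ∪ F := by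
      intro x
      split_ifs
      · exact Finset.mem_union_left _ (hγF' x)
      · exact Finset.mem_union_right _ (hγF x)
    refine ⟨Y \ U, fun x => if x ∈ U then γ' x else γ x, F' ∪ F, hY.diff hU, hγ'', hF'',
      fun m => ⟨?_, fun k hk => ?_⟩⟩
    · rw [m.set_diff hY hU hUY, pow_succ]
      have h1 := (hm m).1
      have h2 := (hm' m).1
      nlinarith
    · rw [m.set_diff hY hU hUY]
      have hc := measurableSet_cut hγ' hγF' k hU hY
      have hc' := measurableSet_cut hγ' hγF' k⁻¹ hU hY
      have hcp : MeasurableSet {x | k • x ∈ cut U Y γ' k⁻¹} := measurable_const_smul k hc'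
      have hs := measurableSet_separated hγ hγF k hY
      have h1 := m.set_mono (measurableSet_separated hγ'' hF'' k (hY.diff hU))
        (hs.union (hc.union hcp)) fun x _ hx => separated_diff_subset hUY γ γ' k hx
      have h2 := m.set_union_le hs (hc.union hcp)
      have h3 := m.set_union_le hc hcp
      rw [m.set_preimage_smul k hc'] at h3
      have h4 := (hm m).2 k hk
      have h5 := (hm' m).2 k hk
      have h6 := (hm' m).2 k⁻¹ (hK k hk)
      linarith

/-- Actions of amenable groups admit measurable labels with finitely many values whose fibres
have small boundary with respect to all invariant means. -/
theorem exists_label (hG : IsAmenableGroup G) (K : Finset G) {ε : ℝ} (hε : 0 < ε) :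
    ∃ (γ : Z → G) (F : Finset G), (∀ g, MeasurableSet {x | γ x = g}) ∧ (∀ x, γ x ∈ F) ∧
      ∀ m : InvMean G Z, m.set {x | ∃ k ∈ K, root γ (k • x) ≠ root γ x} ≤ ε := by
  set K' := K ∪ K⁻¹ with hK'
  have hK : ∀ k ∈ K', k⁻¹ ∈ K' := by
    intro k hk
    rcases Finset.mem_union.1 hk with h | h
    · exact Finset.mem_union_right _ (Finset.inv_mem_inv h)
    · exact Finset.mem_union_left _ (Finset.mem_inv'.1 h)
  set N : ℝ := K.card + 1 with hN
  have hN0 : 0 < N := by positivity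
  -- Each element of `K` has the budget `ε / N`. Half of it pays for separated pairs, at most `8 *
  -- α`, and half for the uncovered set, at most `(1 - α / 2) ^ j`.
  set α : ℝ := min (1 / 2) (ε / (16 * N)) with hα
  have hα0 : 0 < α := by positivity
  have hα1 : α ≤ 1 / 2 := min_le_left _ _
  have hα2 : 8 * α * N ≤ ε / 2 := by
    have h := min_le_right (1 / 2) (ε / (16 * N))
    rw [← hα, le_div_iff₀ (by positivity)] at h
    linarith
  obtain ⟨j, hj⟩ := exists_pow_lt_of_lt_one (show 0 < ε / (2 * N) by positivity)
    (show 1 - α / 2 < 1 by linarith)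
  obtain ⟨Y, γ, F, hY, hγ, hγF, hm⟩ := exists_partial_label (Z := Z) hG hK hα0 hα1 j
  refine ⟨γ, F, hγ, hγF, fun m => ?_⟩
  have hset : {x | ∃ k ∈ K, root γ (k • x) ≠ root γ x} =
      ⋃ k ∈ K, {x | root γ (k • x) ≠ root γ x} := by
    ext x
    simp
  have hk : ∀ k, MeasurableSet {x | root γ (k • x) ≠ root γ x} :=
    fun k => (measurableSet_root_eq hγ hγF k).compl
  have hbd : ∀ k ∈ K, m.set {x | root γ (k • x) ≠ root γ x} ≤ ε / N := by
    intro k hkK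
    have hs := measurableSet_separated hγ hγF k hY
    have h1 : m.set {x | root γ (k • x) ≠ root γ x} ≤ m.set (separated Y γ k ∪ Y) := by
      refine m.set_mono (hk k) (hs.union hY) fun x _ hx => ?_
      by_cases hxY : x ∈ Y
      · exact Or.inr hxY
      · exact Or.inl ⟨fun h => hxY h.1, fun h => hx h.2.2⟩
    have h2 := m.set_union_le hs hY
    have h3 := (hm m).1
    have h4 := (hm m).2 k (Finset.mem_union_left _ hkK)
    have h5 := m.set_nonneg hY
    have h6 : 8 * α ≤ ε / (2 * N) := by
      rw [le_div_iff₀ (by positivity)]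
      linarith
    have h7 : ε / N = ε / (2 * N) + ε / (2 * N) := by
      field_simp
      norm_num
    nlinarith
  rw [hset]
  calc m.set (⋃ k ∈ K, {x | root γ (k • x) ≠ root γ x})
      ≤ ∑ k ∈ K, m.set {x | root γ (k • x) ≠ root γ x} := m.set_biUnion_le K hk
    _ ≤ ∑ _k ∈ K, ε / N := Finset.sum_le_sum hbd
    _ = K.card * (ε / N) := by rw [Finset.sum_const, nsmul_eq_mul]
    _ ≤ N * (ε / N) := by
        gcongr
        rw [hN]
        linarith
    _ = ε := by field_simp

end Hyperfinite

/-! ### The upper bound for the profile of an action -/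

section Upper

variable {G : Type u} [Group G] {X : Type v} [MulAction G X]

lemma IsSymmGenSet.countable {S : Finset G} (hS : IsSymmGenSet S) : Countable G := by
  have h : Function.Surjective (FreeGroup.lift (fun s : S => (s : G))) := by
    rw [← MonoidHom.range_eq_top, FreeGroup.range_lift_eq_closure]
    simpa using hS.closure_eq_top
  have : Countable (FreeGroup S) := Quot.mk_surjective.countable
  exact h.countable

/-! ### Refining a label along a multi-tile -/

namespace MultiTile

variable (T : MultiTile G)

/-- The tile that contains `g`, given by the index of its shape and its center. -/
def tile (g : G) : Fin T.N × G := (T.exists_centers.choose_spec g).choose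

/-- The position of `g` in its tile. -/
def pos (g : G) : G := g * (T.tile g).2⁻¹

lemma tile_spec (g : G) : (T.tile g).2 ∈ T.exists_centers.choose (T.tile g).1 ∧
    T.pos g ∈ T.shape (T.tile g).1 := by
  obtain ⟨h1, t, ht, h2⟩ := (T.exists_centers.choose_spec g).choose_spec.1
  refine ⟨h1, ?_⟩
  have : T.pos g = t := by
    unfold pos
    rw [mul_inv_eq_iff_eq_mul]
    exact h2
  rwa [this]

lemma pos_mul (g : G) : T.pos g * (T.tile g).2 = g := by simp [pos]

lemma tile_mul {g t : G} (ht : t ∈ T.shape (T.tile g).1) :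
    T.tile (t * (T.tile g).2) = T.tile g :=
  ((T.exists_centers.choose_spec (t * (T.tile g).2)).choose_spec.2 _
    ⟨(T.tile_spec g).1, t, ht, rfl⟩).symm

lemma pos_mul_center {g t : G} (ht : t ∈ T.shape (T.tile g).1) :
    T.pos (t * (T.tile g).2) = t := by
  simp [pos, T.tile_mul ht]

lemma boundaryRatio_le_maxRatio (S : Finset G) (i : Fin T.N) :
    boundaryRatio S (T.shape i) ≤ T.maxRatio S :=
  le_ciSup (f := fun i => boundaryRatio S (T.shape i)) (Set.finite_range _).bddAbove i

lemma card_boundary_le (S : Finset G) (i : Fin T.N) :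
    ((boundary S (T.shape i)).card : ℝ) ≤ T.maxRatio S * (T.shape i).card := by
  have h := T.boundaryRatio_le_maxRatio S i
  have h0 : (0 : ℝ) < (T.shape i).card := by
    exact_mod_cast Finset.card_pos.2 ⟨1, T.one_mem i⟩
  rwa [boundaryRatio, div_le_iff₀ h0] at h

lemma maxRatio_nonneg (S : Finset G) : 0 ≤ T.maxRatio S :=
  Real.iSup_nonneg fun _ => by unfold boundaryRatio; positivity

/-- All positions in shapes. -/
def positions : Finset G := insert 1 (Finset.univ.biUnion T.shape)

lemma mem_positions {i : Fin T.N} {t : G} (ht : t ∈ T.shape i) : t ∈ T.positions :=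
  Finset.mem_insert_of_mem (Finset.mem_biUnion.2 ⟨i, Finset.mem_univ i, ht⟩)

/-- The points whose tile, transported to the fibre of the label `γ`, lies inside that fibre. -/
def Full (γ : X → G) (x : X) : Prop :=
  ∀ t ∈ T.shape (T.tile (γ x)).1, γ ((t * (T.pos (γ x))⁻¹) • x) = t * (T.tile (γ x)).2

/-- The refinement of the label `γ` along the tiling. -/
def refineLabel (γ : X → G) (x : X) : G := if T.Full γ x then T.pos (γ x) else 1

variable {T} {γ : X → G}

/-- Fullness is a condition on the whole tile, and `t * (T.pos (γ x))⁻¹` moves `x` to position `t`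
of that tile. So full points come in complete copies of tiles. -/
lemma Full.translate {x : X} (hx : T.Full γ x) {t : G} (ht : t ∈ T.shape (T.tile (γ x)).1) :
    T.Full γ ((t * (T.pos (γ x))⁻¹) • x) ∧
    T.tile (γ ((t * (T.pos (γ x))⁻¹) • x)) = T.tile (γ x) ∧
    T.pos (γ ((t * (T.pos (γ x))⁻¹) • x)) = t := by
  have h1 := hx t ht
  have h2 : T.tile (γ ((t * (T.pos (γ x))⁻¹) • x)) = T.tile (γ x) := by rw [h1, T.tile_mul ht]
  have h3 : T.pos (γ ((t * (T.pos (γ x))⁻¹) • x)) = t := by rw [h1, T.pos_mul_center ht]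
  refine ⟨fun t' ht' => ?_, h2, h3⟩
  rw [h2] at ht' ⊢
  rw [h3, ← mul_smul]
  simpa [mul_assoc] using hx t' ht'

lemma Full.root_eq {x : X} (hx : T.Full γ x) :
    root (T.refineLabel γ) x = (1 * (T.pos (γ x))⁻¹) • x := by
  simp [root, refineLabel, hx]

lemma root_eq_self {x : X} (hx : ¬ T.Full γ x) : root (T.refineLabel γ) x = x := by
  simp [root, refineLabel, hx]

lemma Full.root {x : X} (hx : T.Full γ x) : T.Full γ (root (T.refineLabel γ) x) ∧
    T.tile (γ (root (T.refineLabel γ) x)) = T.tile (γ x) ∧ T.pos (γ (root (T.refineLabel γ) x)) = 1 := by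
  rw [hx.root_eq]
  exact hx.translate (T.one_mem _)

lemma full_of_full_root {x : X} (hx : T.Full γ (root (T.refineLabel γ) x)) : T.Full γ x := by
  by_contra h
  rw [root_eq_self h] at hx
  exact h hx

/-- The fibre of the refined label over the root of a full point is a tile. -/
lemma refineLabel_smul_eq_iff {z : X} (hz : T.Full γ z) (hz1 : T.pos (γ z) = 1) {t : G} :
    T.refineLabel γ (t • z) = t ↔ t ∈ T.shape (T.tile (γ z)).1 := by
  constructor
  · intro h
    have hr : IsoProfile.root (T.refineLabel γ) (t • z) = z := by simp [IsoProfile.root, h]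
    have hf : T.Full γ (t • z) := full_of_full_root (by rwa [hr])
    have h2 := hf.root.2.1
    rw [hr] at h2
    have h3 : T.pos (γ (t • z)) = t := by simpa [refineLabel, hf] using h
    have h4 := (T.tile_spec (γ (t • z))).2
    rwa [h3, ← h2] at h4
  · intro h
    have := hz.translate h
    rw [hz1, inv_one, mul_one] at this
    simp [refineLabel, this.1, this.2.2]

lemma root_smul_of_mem {z : X} (hz : T.Full γ z) (hz1 : T.pos (γ z) = 1) {t : G}
    (ht : t ∈ T.shape (T.tile (γ z)).1) : IsoProfile.root (T.refineLabel γ) (t • z) = z := by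
  have := (refineLabel_smul_eq_iff hz hz1).2 ht
  simp [IsoProfile.root, this]

lemma refineLabel_mem_positions (x : X) : T.refineLabel γ x ∈ T.positions := by
  unfold refineLabel
  split_ifs
  · exact T.mem_positions (T.tile_spec _).2
  · exact Finset.mem_insert_self _ _

/-- The root of a full point is full, so full and other points never share a class. A class is thus
the image of a shape or a singleton. -/
lemma fibre_encard_le {n : ℕ} (hT : T.SizeLE n) (hn : 1 ≤ n) (x : X) :
    {y | IsoProfile.root (T.refineLabel γ) x = IsoProfile.root (T.refineLabel γ) y}.encard ≤ n := by
  by_cases hx : T.Full γ x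
  · set z := IsoProfile.root (T.refineLabel γ) x with hzdef
    obtain ⟨hz, hzt, hz1⟩ := hx.root
    have hsub : {y | z = IsoProfile.root (T.refineLabel γ) y} ⊆
        ((T.shape (T.tile (γ z)).1).image (fun t => t • z) : Finset X) := by
      intro y hy
      have hy : z = IsoProfile.root (T.refineLabel γ) y := hy
      have h1 : y = T.refineLabel γ y • z := by rw [hy]; simp [IsoProfile.root]
      have h2 := (refineLabel_smul_eq_iff hz hz1).1 (by rw [← h1])
      exact Finset.mem_coe.2 (Finset.mem_image.2 ⟨_, h2, h1.symm⟩)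
    refine (Set.encard_le_encard hsub).trans ?_
    rw [Set.encard_coe_eq_coe_finsetCard]
    exact_mod_cast Finset.card_image_le.trans (hT _)
  · have hsub : {y | IsoProfile.root (T.refineLabel γ) x = IsoProfile.root (T.refineLabel γ) y} ⊆ {x} := by
      intro y hy
      have hy : IsoProfile.root (T.refineLabel γ) x = IsoProfile.root (T.refineLabel γ) y := hy
      rw [root_eq_self hx] at hy
      by_cases hfy : T.Full γ y
      · have := hfy.root.1
        rw [← hy] at this
        exact absurd this hx
      · rw [root_eq_self hfy] at hy
        exact hy.symm
    refine (Set.encard_le_encard hsub).trans ?_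
    rw [Set.encard_singleton]
    exact_mod_cast hn

lemma one_le_of_sizeLE {n : ℕ} (hT : T.SizeLE n) : 1 ≤ n :=
  (Nat.succ_le_of_lt (Finset.card_pos.2 ⟨1, T.one_mem (T.tile 1).1⟩)).trans (hT _)

variable (T) in
/-- The boundary of the refined label is at most the largest boundary ratio, up to the points that
are not full. -/
lemma sum_boundary_le (S : Finset G) (z : X) :
    ∑ t ∈ T.positions with T.refineLabel γ (t • z) = t,
      (if t • z ∈ {x | ∃ s ∈ S, IsoProfile.root (T.refineLabel γ) (s • x) ≠
        IsoProfile.root (T.refineLabel γ) x} then (1 : ℝ) else 0) ≤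
    ∑ t ∈ T.positions with T.refineLabel γ (t • z) = t,
      (T.maxRatio S + if t • z ∈ {x | ¬ T.Full γ x} then (1 : ℝ) else 0) := by
  have hr0 := T.maxRatio_nonneg S
  by_cases hz : T.Full γ z ∧ T.pos (γ z) = 1
  · obtain ⟨hz, hz1⟩ := hz
    have hfil : T.positions.filter (fun t => T.refineLabel γ (t • z) = t) =
        T.shape (T.tile (γ z)).1 := by
      ext t
      rw [Finset.mem_filter]
      exact ⟨fun h => (refineLabel_smul_eq_iff hz hz1).1 h.2,
        fun h => ⟨T.mem_positions h, (refineLabel_smul_eq_iff hz hz1).2 h⟩⟩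
    rw [hfil]
    calc _ ≤ ((boundary S (T.shape (T.tile (γ z)).1)).card : ℝ) := by
          rw [Finset.sum_boole]
          refine Nat.cast_le.2 (Finset.card_le_card fun t ht => ?_)
          obtain ⟨h1, s, hs, h2⟩ := Finset.mem_filter.1 ht
          refine Finset.mem_filter.2 ⟨h1, s, hs, fun h3 => h2 ?_⟩
          rw [← mul_smul, root_smul_of_mem hz hz1 h1, root_smul_of_mem hz hz1 h3]
      _ ≤ T.maxRatio S * (T.shape (T.tile (γ z)).1).card := T.card_boundary_le S _
      _ = ∑ t ∈ T.shape (T.tile (γ z)).1, T.maxRatio S := by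
          rw [Finset.sum_const, nsmul_eq_mul, mul_comm]
      _ ≤ _ := by
          refine Finset.sum_le_sum fun t _ => ?_
          split_ifs <;> linarith
  · refine Finset.sum_le_sum fun t ht => ?_
    have h1 := (Finset.mem_filter.1 ht).2
    have h2 : ¬ T.Full γ (t • z) := by
      intro h
      have h3 := h.root
      have hr : IsoProfile.root (T.refineLabel γ) (t • z) = z := by simp [IsoProfile.root, h1]
      rw [hr] at h3
      exact hz ⟨h3.1, h3.2.2⟩
    rw [if_pos (show t • z ∈ {x | ¬ T.Full γ x} from h2)]
    split_ifs <;> linarith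

/-- A free point that is not full lies near the boundary of the original label. -/
lemma exists_of_not_full {x : X} (hx : x ∈ freePart G X) (hnf : ¬ T.Full γ x) :
    ∃ k ∈ T.positions * T.positions⁻¹,
      IsoProfile.root γ (k • x) ≠ IsoProfile.root γ x := by
  unfold Full at hnf
  push Not at hnf
  obtain ⟨t, ht, h⟩ := hnf
  refine ⟨t * (T.pos (γ x))⁻¹, Finset.mul_mem_mul (T.mem_positions ht)
    (Finset.inv_mem_inv (T.mem_positions (T.tile_spec _).2)), fun hr => h ?_⟩
  set k := t * (T.pos (γ x))⁻¹ with hk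
  -- Equal roots mean `γ(kx)⁻¹kx = γ(x)⁻¹x`; freeness turns this into `γ(kx) = kγ(x)`, the label
  -- that fullness demands.
  have h1 : (γ x * ((γ (k • x))⁻¹ * k)) • x = x := by
    rw [mul_smul, mul_smul]
    change γ x • IsoProfile.root γ (k • x) = x
    rw [hr]
    simp [IsoProfile.root]
  have h2 := hx _ h1
  have h3 : γ (k • x) = k * γ x := by
    have h4 : (γ (k • x))⁻¹ * k = (γ x)⁻¹ := eq_inv_of_mul_eq_one_right h2
    rw [inv_mul_eq_iff_eq_mul] at h4
    rw [eq_mul_inv_iff_mul_eq] at h4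
    exact h4.symm
  rw [h3, hk]
  conv_lhs => rw [← T.pos_mul (γ x)]
  rw [T.pos_mul]
  simp [pos, mul_assoc]

end MultiTile

variable [MeasurableSpace X]

lemma IsEssFreePMP.measurableConstSMul {μ : Measure X} (hμ : IsEssFreePMP G μ) :
    MeasurableConstSMul G X := ⟨fun g => (hμ.measurePreserving g).measurable⟩

lemma IsEssFreePMP.ae_mem_freePart [Countable G] {μ : Measure X} (hμ : IsEssFreePMP G μ) :
    ∀ᵐ x ∂μ, x ∈ freePart G X := by
  have : ∀ g : G, ∀ᵐ x ∂μ, g • x = x → g = 1 := by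
    intro g
    by_cases hg : g = 1
    · simp [hg]
    · have := hμ.ess_free g hg
      rw [ae_iff]
      simpa [hg] using this
  exact ae_all_iff.2 this

lemma IsBddMeas.integrable {μ : Measure X} [IsFiniteMeasure μ] {f : X → ℝ} (hf : IsBddMeas f) :
    Integrable f μ := by
  obtain ⟨h, C, hC⟩ := hf
  exact Integrable.of_bound h.aestronglyMeasurable C (ae_of_all _ hC)

/-- Integration with respect to an essentially free invariant probability measure. -/
def integralMean [Countable G] {μ : Measure X} [IsProbabilityMeasure μ]
    (hμ : IsEssFreePMP G μ) : InvMean G X where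
  toFun f := ∫ x, f x ∂μ
  map_add _ _ hf hh := integral_add hf.integrable hh.integrable
  map_mul a _ _ := integral_const_mul a _
  mono _ _ hf hh h := integral_mono_ae hf.integrable hh.integrable
    (hμ.ae_mem_freePart.mono h)
  map_one := by simp
  map_smul g f hf := by
    have h := hμ.measurePreserving g
    conv_rhs => rw [← h.map_eq]
    exact (integral_map h.measurable.aemeasurable hf.1.aestronglyMeasurable).symm

lemma integralMean_set [Countable G] {μ : Measure X} [IsProbabilityMeasure μ]
    (hμ : IsEssFreePMP G μ) {A : Set X} (hA : MeasurableSet A) :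
    (integralMean hμ).set A = μ.real A := by
  change ∫ x, (if x ∈ A then (1 : ℝ) else 0) ∂μ = _
  rw [← integral_indicator_one hA]
  congr 1

lemma measurableSet_full [MeasurableConstSMul G X] {γ : X → G}
    (hγ : ∀ g, MeasurableSet {x | γ x = g}) {F : Finset G} (hF : ∀ x, γ x ∈ F) (T : MultiTile G) :
    MeasurableSet {x | T.Full γ x} := by
  have : {x | T.Full γ x} = ⋃ g ∈ F, {x | γ x = g} ∩ ⋂ t ∈ T.shape (T.tile g).1,
      {x | γ ((t * (T.pos g)⁻¹) • x) = t * (T.tile g).2} := by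
    ext x
    simp [MultiTile.Full, hF x]
  rw [this]
  exact F.measurableSet_biUnion fun g _ => (hγ g).inter
    (Finset.measurableSet_biInter _ fun t _ =>
      measurable_const_smul (t * (T.pos g)⁻¹) (hγ (t * (T.tile g).2)))

lemma measurableSet_refineLabel_eq [MeasurableConstSMul G X] {γ : X → G}
    (hγ : ∀ g, MeasurableSet {x | γ x = g}) {F : Finset G} (hF : ∀ x, γ x ∈ F) (T : MultiTile G)
    (g : G) : MeasurableSet {x | T.refineLabel γ x = g} := by
  have hfull := measurableSet_full hγ hF T
  have : {x | T.refineLabel γ x = g} = ({x | T.Full γ x} ∩ ⋃ h ∈ F, {x | γ x = h} ∩ {_x | T.pos h = g}) ∪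
      ({x | T.Full γ x}ᶜ ∩ {_x | (1 : G) = g}) := by
    ext x
    by_cases hx : T.Full γ x <;> simp [MultiTile.refineLabel, hx, hF x]
  rw [this]
  exact (hfull.inter (F.measurableSet_biUnion fun h _ => (hγ h).inter (.const _))).union
    (hfull.compl.inter (.const _))

/-- The profile of an essentially free action is bounded by the boundary ratio of a multi-tile. -/
theorem actionProfile_le_maxRatio (hG : IsAmenableGroup G) [Countable G] (S : Finset G)
    [StandardBorelSpace X] {μ : Measure X} [IsProbabilityMeasure μ] (hμ : IsEssFreePMP G μ) {n : ℕ}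
    {T : MultiTile G} (hT : T.SizeLE n) : actionProfile S μ n ≤ T.maxRatio S := by
  have := hμ.measurableConstSMul
  refine le_of_forall_pos_le_add fun ε hε => ?_
  obtain ⟨γ, F, hγ, hF, hm⟩ := exists_label (Z := X) hG (T.positions * T.positions⁻¹) hε
  have hrm := measurableSet_refineLabel_eq hγ hF T
  have hrF : ∀ x, T.refineLabel γ x ∈ T.positions := MultiTile.refineLabel_mem_positions
  have hroot := measurable_root hrm hrF
  let θ : Setoid X := Setoid.ker (root (T.refineLabel γ))
  have hθ : IsSubrelation G θ n := by
    refine ⟨?_, fun {x y} hxy => ?_, fun x => ?_⟩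
    · exact measurableSet_eq_fun (hroot.comp measurable_fst) (hroot.comp measurable_snd)
    · have hxy : root (T.refineLabel γ) x = root (T.refineLabel γ) y := hxy
      refine ⟨T.refineLabel γ x * (T.refineLabel γ y)⁻¹, ?_⟩
      change (T.refineLabel γ x * (T.refineLabel γ y)⁻¹) • y = x
      rw [mul_smul]
      change T.refineLabel γ x • root (T.refineLabel γ) y = x
      rw [← hxy]
      simp [root]
    · exact MultiTile.fibre_encard_le hT (MultiTile.one_le_of_sizeLE hT) x
  have hbd : relBoundary S θ =
      {x | ∃ s ∈ S, root (T.refineLabel γ) (s • x) ≠ root (T.refineLabel γ) x} := by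
    ext x
    exact exists_congr fun s => and_congr_right fun _ => not_congr eq_comm
  have hmeas : ∀ (δ : X → G) (D K : Finset G), (∀ g, MeasurableSet {x | δ x = g}) →
      (∀ x, δ x ∈ D) → MeasurableSet {x | ∃ k ∈ K, root δ (k • x) ≠ root δ x} := by
    intro δ D K h1 h2
    have : {x | ∃ k ∈ K, root δ (k • x) ≠ root δ x} =
        ⋃ k ∈ K, {x | root δ (k • x) = root δ x}ᶜ := by
      ext x
      simp
    rw [this]
    exact K.measurableSet_biUnion fun k _ => (measurableSet_root_eq h1 h2 k).compl
  have hfull := (measurableSet_full hγ hF T).compl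
  have h1 := (integralMean hμ).le_of_fiberwise hrm hrF (.indicator (hmeas _ _ S hrm hrF))
    ((IsBddMeas.const (T.maxRatio S)).add (.indicator hfull)) 
    (fun z => by convert T.sum_boundary_le (γ := γ) S z; rfl)
  rw [(integralMean hμ).map_add _ _ (.const _) (.indicator hfull), InvMean.map_const] at h1
  have h2 : (integralMean hμ).set {x | T.Full γ x}ᶜ ≤ ε :=
    ((integralMean hμ).set_mono hfull (hmeas _ _ _ hγ hF)
      fun x hx hnf => MultiTile.exists_of_not_full hx hnf).trans (hm _)
  have h3 : actionProfile S μ n ≤ μ.real (relBoundary S θ) :=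
    csInf_le ⟨0, by rintro r ⟨θ', -, rfl⟩; exact measureReal_nonneg⟩ ⟨θ, hθ, rfl⟩
  rw [hbd, ← integralMean_set hμ (hmeas _ _ S hrm hrF)] at h3
  exact h3.trans (h1.trans (by gcongr; exact h2))

end Upper

/-! ### The lower bound for the profile of an action -/

section Lower

open scoped ENNReal

variable {G : Type u} [Group G] {X : Type v} [MulAction G X]

lemma groupProfile_le_boundaryRatio (S : Finset G) {F : Finset G} {n : ℕ} (hF : F.Nonempty)
    (hn : F.card ≤ n) : groupProfile S n ≤ boundaryRatio S F :=
  csInf_le ⟨0, by rintro r ⟨F, -, -, rfl⟩; unfold boundaryRatio; positivity⟩ ⟨F, hF, hn, rfl⟩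

lemma groupProfile_nonneg (S : Finset G) (n : ℕ) : 0 ≤ groupProfile S n :=
  Real.sInf_nonneg (by rintro r ⟨F, -, -, rfl⟩; unfold boundaryRatio; positivity)

/-- The class of a free point, pulled back to the group. -/
lemma exists_finset_class {x : X} (hx : x ∈ freePart G X) {θ : Setoid X} {n : ℕ}
    (hn : {y : X | θ x y}.encard ≤ n) :
    ∃ F : Finset G, (∀ g, g ∈ F ↔ θ x (g • x)) ∧ F.Nonempty ∧ F.card ≤ n := by
  have hinj : Function.Injective (fun g : G => g • x) := by
    intro g h hgh
    have : (h⁻¹ * g) • x = x := by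
      rw [mul_smul]
      exact (inv_smul_eq_iff).2 hgh
    exact (inv_mul_eq_one.1 (hx _ this)).symm
  have h1 : {g : G | θ x (g • x)}.encard ≤ n := by
    rw [← hinj.encard_image]
    refine (Set.encard_le_encard ?_).trans hn
    rintro _ ⟨g, hg, rfl⟩
    exact hg
  have hfin : {g : G | θ x (g • x)}.Finite :=
    Set.finite_of_encard_le_coe h1
  refine ⟨hfin.toFinset, fun g => by simp, ⟨1, by simp⟩, ?_⟩
  rw [hfin.encard_eq_coe_toFinset_card] at h1
  exact_mod_cast h1

/-- The number of group elements that move `x` inside its class. -/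
def classCard (G : Type u) [Group G] {X : Type v} [MulAction G X] (θ : Setoid X) (x : X) : ℝ≥0∞ :=
  ∑' g : G, if θ x (g • x) then 1 else 0

lemma classCard_smul {θ : Setoid X} {x : X} {g : G} (h : θ x (g • x)) :
    classCard G θ (g • x) = classCard G θ x := by
  unfold classCard
  rw [← (Equiv.mulRight g).tsum_eq (fun h : G => if θ x (h • x) then (1 : ℝ≥0∞) else 0)]
  refine tsum_congr fun k => ?_
  have : θ (g • x) (k • g • x) ↔ θ x ((Equiv.mulRight g k) • x) := by
    rw [Equiv.coe_mulRight, mul_smul]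
    exact ⟨fun h' => θ.trans' h h', fun h' => θ.trans' (θ.symm' h) h'⟩
  simp only [this]

variable [MeasurableSpace X]

/-- The isoperimetric profile of the group bounds the boundary of a bounded subrelation. -/
theorem groupProfile_le_measure_relBoundary [Countable G] (S : Finset G) {μ : Measure X}
    [IsProbabilityMeasure μ] (hμ : IsEssFreePMP G μ) {θ : Setoid X} {n : ℕ}
    (hθ : IsSubrelation G θ n) : groupProfile S n ≤ μ.real (relBoundary S θ) := by
  have hms := hμ.measurableConstSMul
  have hrel : ∀ g : G, MeasurableSet {x | θ x (g • x)} := fun g =>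
    hθ.measurableSet.preimage (measurable_id.prodMk (measurable_const_smul g))
  have hB : MeasurableSet (relBoundary S θ) := by
    have : relBoundary S θ = ⋃ s ∈ S, {x | θ x (s • x)}ᶜ := by
      ext x
      simp [relBoundary]
    rw [this]
    exact S.measurableSet_biUnion fun s _ => (hrel s).compl
  set N := classCard G θ with hN
  have hNm : Measurable N :=
    Measurable.tsum fun g => Measurable.ite (hrel g) measurable_const measurable_const
  set B : X → ℝ≥0∞ := fun x => if x ∈ relBoundary S θ then 1 else 0 with hBdef
  have hBm : Measurable B := Measurable.ite hB measurable_const measurable_const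
  -- Mass transport: a boundary point `x` spreads unit mass evenly over its class, `φ g x` going to
  -- `g⁻¹x`. The mass sent by `x` is `B x`; the mass received at `x` is `|∂F| / |F|` for its class
  -- `F`. Invariance of `μ` equates the integrals.
  let φ : G → X → ℝ≥0∞ := fun g x => B x * (if θ x (g⁻¹ • x) then 1 else 0) * (N x)⁻¹
  have hφ : ∀ g, Measurable (φ g) := fun g =>
    (hBm.mul (Measurable.ite (hrel g⁻¹) measurable_const measurable_const)).mul hNm.inv
  have hfree := hμ.ae_mem_freePart
  have hNF : ∀ {x : X} {F : Finset G}, (∀ g, g ∈ F ↔ θ x (g • x)) → N x = F.card := by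
    intro x F hF
    rw [hN, classCard, tsum_eq_sum (s := F) (fun g hg => if_neg fun h => hg ((hF g).2 h))]
    rw [Finset.sum_congr rfl fun g hg => if_pos ((hF g).1 hg)]
    simp
  have h1 : ∫⁻ x, B x ∂μ = ∫⁻ x, ∑' g, φ g x ∂μ := by
    refine lintegral_congr_ae (hfree.mono fun x hx => ?_)
    obtain ⟨F, hF, hFne, -⟩ := exists_finset_class hx (hθ.encard_le x)
    have e1 : ∑' g : G, (if θ x (g⁻¹ • x) then (1 : ℝ≥0∞) else 0) = N x :=
      (Equiv.inv G).tsum_eq (fun g : G => if θ x (g • x) then (1 : ℝ≥0∞) else 0)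
    simp only [φ]
    rw [ENNReal.tsum_mul_right, ENNReal.tsum_mul_left, e1, mul_assoc, ENNReal.mul_inv_cancel,
      mul_one]
    · rw [hNF hF]
      exact_mod_cast hFne.card_pos.ne'
    · rw [hNF hF]
      exact ENNReal.natCast_ne_top _
  have h2 : ∫⁻ x, ∑' g, φ g x ∂μ = ∫⁻ x, ∑' g, φ g (g • x) ∂μ := by
    have hφ' : ∀ g, Measurable (fun x => φ g (g • x)) := fun g =>
      (hφ g).comp (measurable_const_smul g)
    rw [lintegral_tsum fun g => (hφ g).aemeasurable, lintegral_tsum fun g => (hφ' g).aemeasurable]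
    exact tsum_congr fun g => ((hμ.measurePreserving g).lintegral_comp (hφ g)).symm
  have h3 : ∀ᵐ x ∂μ, ENNReal.ofReal (groupProfile S n) ≤ ∑' g, φ g (g • x) := by
    refine hfree.mono fun x hx => ?_
    obtain ⟨F, hF, hFne, hFn⟩ := exists_finset_class hx (hθ.encard_le x)
    have e1 : ∀ g, φ g (g • x) = (if g ∈ boundary S F then 1 else 0) * (N x)⁻¹ := by
      intro g
      simp only [φ, inv_smul_smul, hBdef]
      by_cases hg : g ∈ F
      · have hg' := (hF g).1 hg
        have e2 : g • x ∈ relBoundary S θ ↔ g ∈ boundary S F := by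
          simp only [relBoundary, boundary, Finset.mem_filter, hg, true_and]
          refine exists_congr fun s => and_congr_right fun _ => not_congr ?_
          rw [hF, mul_smul]
          exact ⟨fun h => θ.trans' hg' h, fun h => θ.trans' (θ.symm' hg') h⟩
        rw [if_pos (θ.symm' hg'), mul_one, hN, classCard_smul hg']
        simp only [e2]
      · have e3 : ¬ θ (g • x) x := fun h => hg ((hF g).2 (θ.symm' h))
        have e4 : g ∉ boundary S F := fun h => hg (Finset.mem_filter.1 h).1
        simp [e3, e4]
    have e5 : ∑' g, φ g (g • x) = ((boundary S F).card : ℝ≥0∞) * (F.card : ℝ≥0∞)⁻¹ := by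
      rw [tsum_congr e1, ENNReal.tsum_mul_right, hNF hF, tsum_eq_sum (s := boundary S F)
        (fun g hg => if_neg hg), Finset.sum_congr rfl fun g hg => if_pos hg]
      simp
    rw [e5, ← div_eq_mul_inv]
    have hc : (0 : ℝ) < F.card := by exact_mod_cast hFne.card_pos
    refine (ENNReal.ofReal_le_ofReal (groupProfile_le_boundaryRatio S hFne hFn)).trans ?_
    rw [boundaryRatio, ENNReal.ofReal_div_of_pos hc, ENNReal.ofReal_natCast,
      ENNReal.ofReal_natCast]
  have h4 : ∫⁻ x, B x ∂μ = μ (relBoundary S θ) := by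
    rw [← lintegral_indicator_one hB]
    congr 1
  have h5 : ENNReal.ofReal (groupProfile S n) ≤ μ (relBoundary S θ) := by
    rw [← h4, h1, h2]
    calc ENNReal.ofReal (groupProfile S n)
        = ∫⁻ _, ENNReal.ofReal (groupProfile S n) ∂μ := by simp
      _ ≤ _ := lintegral_mono_ae h3
  exact (ENNReal.ofReal_le_iff_le_toReal (measure_ne_top _ _)).1 h5

theorem groupProfile_le_actionProfile [Countable G] [StandardBorelSpace X] (S : Finset G)
    {μ : Measure X} [IsProbabilityMeasure μ] (hμ : IsEssFreePMP G μ) {n : ℕ} (hn : 1 ≤ n) :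
    groupProfile S n ≤ actionProfile S μ n := by
  -- Equality is an admissible relation because `n ≥ 1`, so the infimum is not the default value at
  -- the empty set.
  refine le_csInf ⟨_, ⊥, ⟨?_, bot_le, fun x => ?_⟩, rfl⟩ ?_
  · exact measurableSet_diagonal
  · have : {y : X | (⊥ : Setoid X) x y} = {x} := by
      ext y
      exact eq_comm
    rw [this, Set.encard_singleton]
    exact_mod_cast hn
  · rintro r ⟨θ, hθ, rfl⟩
    exact groupProfile_le_measure_relBoundary S hμ hθ

end Lower

/-! ### Asymptotics of squeezed sequences -/

section Squeeze

variable {a b t : ℕ → ℝ}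

lemma isEquivalent_of_squeeze (hab : ∀ᶠ n in atTop, a n ≤ b n) (hbt : ∀ᶠ n in atTop, b n ≤ t n)
    (h : t ~[atTop] a) : b ~[atTop] a := by
  refine IsBigO.trans_isLittleO (IsBigO.of_bound 1 ?_) h
  filter_upwards [hab, hbt] with n h1 h2
  simp only [Pi.sub_apply, Real.norm_eq_abs, one_mul]
  rw [abs_of_nonneg (by linarith), abs_of_nonneg (by linarith)]
  linarith

lemma isTheta_of_squeeze (ha : ∀ n, 0 ≤ a n) (hab : ∀ᶠ n in atTop, a n ≤ b n)
    (hbt : ∀ᶠ n in atTop, b n ≤ t n) (h : t =Θ[atTop] a) : b =Θ[atTop] a := by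
  refine ⟨IsBigO.trans (IsBigO.of_bound 1 ?_) h.1, IsBigO.of_bound 1 ?_⟩
  · filter_upwards [hab, hbt] with n h1 h2
    have := ha n
    rw [Real.norm_eq_abs, Real.norm_eq_abs, abs_of_nonneg (by linarith),
      abs_of_nonneg (by linarith)]
    linarith
  · filter_upwards [hab] with n h1
    have := ha n
    rw [Real.norm_eq_abs, Real.norm_eq_abs, abs_of_nonneg (by linarith),
      abs_of_nonneg (by linarith)]
    linarith

end Squeeze

/-! ### Invariant means on the group -/

section GroupMean

variable {G : Type u} [Group G]

/-- The average of `h` over the finite set `W * g`. -/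
def avg (W : Finset G) (g : G) (h : G → ℝ) : ℝ := (∑ x ∈ W, h (x * g)) / W.card

lemma abs_avg_le (W : Finset G) (g : G) {h : G → ℝ} {C : ℝ} (hC : ∀ x, |h x| ≤ C) :
    |avg W g h| ≤ C := by
  have hC0 : 0 ≤ C := (abs_nonneg _).trans (hC 1)
  unfold avg
  rw [abs_div, Nat.abs_cast]
  refine div_le_of_le_mul₀ (Nat.cast_nonneg _) hC0 ?_
  refine (Finset.abs_sum_le_sum_abs _ _).trans ((Finset.sum_le_sum fun x _ => hC _).trans ?_)
  rw [Finset.sum_const, nsmul_eq_mul, mul_comm]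

lemma abs_avg_smul_sub_le {W : Finset G} (hW : W.Nonempty) (g a : G) {h : G → ℝ} {C ε : ℝ}
    (hC : ∀ x, |h x| ≤ C)
    (ha : (((a • (W : Set G)) ∆ (W : Set G)).ncard : ℝ) ≤ ε * (W.card : ℝ)) :
    |avg W g (fun x => h (a * x)) - avg W g h| ≤ C * ε := by
  have hC0 : 0 ≤ C := (abs_nonneg _).trans (hC 1)
  have hW0 : (0 : ℝ) < W.card := by exact_mod_cast hW.card_pos
  have h1 : ∑ x ∈ W, h (a * (x * g)) = ∑ x ∈ a • W, h (x * g) := by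
    rw [Finset.smul_finset_def, Finset.sum_image fun x _ y _ hxy => by simpa using hxy]
    simp [mul_assoc]
  have h2 : (∑ x ∈ a • W, h (x * g)) - ∑ x ∈ W, h (x * g) =
      (∑ x ∈ (a • W) \ W, h (x * g)) - ∑ x ∈ W \ (a • W), h (x * g) := by
    rw [Finset.sum_sdiff_sub_sum_sdiff]
  have h3 : (((a • W) \ W).card : ℝ) + ((W \ (a • W)).card : ℝ) ≤ ε * W.card := by
    refine le_trans (le_of_eq ?_) ha
    rw [← Nat.cast_add, ← Finset.card_union_of_disjoint (disjoint_sdiff_sdiff),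
      ← Set.ncard_coe_finset]
    congr 2
    simp [symmDiff_def]
  have h4 : ∀ V : Finset G, |∑ x ∈ V, h (x * g)| ≤ C * V.card := by
    intro V
    refine (Finset.abs_sum_le_sum_abs _ _).trans ((Finset.sum_le_sum fun x _ => hC _).trans ?_)
    rw [Finset.sum_const, nsmul_eq_mul, mul_comm]
  unfold avg
  rw [h1, ← sub_div, h2, abs_div, Nat.abs_cast, div_le_iff₀ hW0]
  calc _ ≤ C * ((a • W) \ W).card + C * (W \ (a • W)).card :=
        (abs_sub _ _).trans (add_le_add (h4 _) (h4 _))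
    _ = C * (((a • W) \ W).card + (W \ (a • W)).card) := by ring
    _ ≤ C * (ε * W.card) := by gcongr
    _ = C * ε * W.card := by ring

variable [MeasurableSpace G]

/-- The limit of the averages over right translates of Følner sets along an ultrafilter. -/
def ultrafilterMean [MeasurableConstSMul G G] {ι : Type*} (𝒰 : Ultrafilter ι) (W : ι → Finset G)
    (hW : ∀ i, (W i).Nonempty)
    (g : ι → G) (hinv : ∀ (a : G) (ε : ℝ), 0 < ε → ∀ᶠ i in (𝒰 : Filter ι),
      (((a • (W i : Set G)) ∆ (W i : Set G)).ncard : ℝ) ≤ ε * ((W i).card : ℝ)) :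
    InvMean G G :=
  have key : ∀ h : G → ℝ, IsBddMeas h →
      Tendsto (fun i => avg (W i) (g i) h) 𝒰 (𝓝 (limUnder 𝒰 fun i => avg (W i) (g i) h)) := by
    rintro h ⟨-, C, hC⟩
    have hmem : ∀ i, avg (W i) (g i) h ∈ Set.Icc (-C) C := fun i => abs_le.1 (abs_avg_le _ _ hC)
    obtain ⟨x, -, hx⟩ := (isCompact_Icc (a := -C) (b := C)).ultrafilter_le_nhds
      (𝒰.map fun i => avg (W i) (g i) h)
      (le_principal_iff.2 (Filter.mem_map.2 (Filter.univ_mem' hmem)))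
    exact tendsto_nhds_limUnder ⟨x, hx⟩
  { toFun := fun h => limUnder 𝒰 fun i => avg (W i) (g i) h
    map_add := fun f h hf hh => by
      refine tendsto_nhds_unique (key _ (hf.add hh)) (((key f hf).add (key h hh)).congr fun i => ?_)
      simp [avg, Finset.sum_add_distrib, add_div]
    map_mul := fun a f hf => by
      refine tendsto_nhds_unique (key _ (hf.const_mul a)) (((key f hf).const_mul a).congr
        fun i => ?_)
      simp [avg, ← Finset.mul_sum, mul_div_assoc]
    mono := fun f h hf hh hfh => by
      refine le_of_tendsto_of_tendsto' (key f hf) (key h hh) fun i => ?_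
      unfold avg
      gcongr with x
      exact hfh _ fun a ha => by simpa using ha
    map_one := by
      refine tendsto_nhds_unique (key _ (.const 1)) (tendsto_const_nhds.congr fun i => ?_)
      have : ((W i).card : ℝ) ≠ 0 := by exact_mod_cast (hW i).card_pos.ne'
      simp [avg, this]
    map_smul := fun a f hf => by
      obtain ⟨C, hC⟩ := hf.2
      have h1 := (key _ (hf.comp_smul a)).sub (key f hf)
      have h2 : Tendsto (fun i => avg (W i) (g i) (fun x => f (a • x)) - avg (W i) (g i) f) 𝒰
          (𝓝 0) := by
        rw [Metric.tendsto_nhds]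
        intro ε hε
        have hC0 : 0 ≤ C := (abs_nonneg _).trans (hC 1)
        filter_upwards [hinv a (ε / (C + 1)) (by positivity)] with i hi
        rw [Real.dist_eq, sub_zero]
        refine (abs_avg_smul_sub_le (hW i) (g i) a hC hi).trans_lt ?_
        rw [← mul_div_assoc, div_lt_iff₀ (by positivity)]
        nlinarith
      exact sub_eq_zero.1 (tendsto_nhds_unique h1 h2) }

/-- A function with negative mean for all invariant means has nonpositive sums over all right
translates of some finite window. -/
lemma exists_window [DiscreteMeasurableSpace G] (hG : IsAmenableGroup G) {f : G → ℝ}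
    (hf : IsBddMeas f) (H : ∀ m : InvMean G G, m.toFun f < 0) :
    ∃ W : Finset G, W.Nonempty ∧ ∀ g, ∑ x ∈ W, f (x * g) ≤ 0 := by
  have : MeasurableConstSMul G G := ⟨fun _ => .of_discrete⟩
  -- Otherwise every nonempty finite set has a right translate with positive sum. Right translation
  -- does not disturb left invariance, so averages over such translates of ever more invariant
  -- Følner sets have an ultrafilter limit that is an invariant mean, nonnegative at `f`.
  by_contra! hcon
  have h1 : ∀ i : Finset G × ℕ, ∃ F : Finset G, F.Nonempty ∧ ∀ g ∈ i.1,
      (((g • (F : Set G)) ∆ (F : Set G)).ncard : ℝ) ≤ 1 / ((i.2 : ℝ) + 1) * (F.card : ℝ) :=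
    fun i => hG i.1 _ (by positivity)
  choose W hW hinv using h1
  choose g hg using fun i => hcon (W i) (hW i)
  have hinv' : ∀ (a : G) (ε : ℝ), 0 < ε →
      ∀ᶠ i in (Ultrafilter.of (atTop : Filter (Finset G × ℕ)) : Filter (Finset G × ℕ)),
      (((a • (W i : Set G)) ∆ (W i : Set G)).ncard : ℝ) ≤ ε * ((W i).card : ℝ) := by
    intro a ε hε
    refine (Ultrafilter.of_le _) ?_
    obtain ⟨n, hn⟩ := exists_nat_one_div_lt hε
    filter_upwards [eventually_ge_atTop (({a} : Finset G), n)] with i hi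
    refine (hinv i a (hi.1 (by simp))).trans ?_
    gcongr
    refine le_trans ?_ hn.le
    have : (n : ℝ) ≤ i.2 := by exact_mod_cast hi.2
    gcongr
  let m := ultrafilterMean (Ultrafilter.of atTop) W hW g hinv'
  refine (H m).not_ge ?_
  obtain ⟨-, C, hC⟩ := hf
  have hmem : ∀ i, avg (W i) (g i) f ∈ Set.Icc (-C) C := fun i => abs_le.1 (abs_avg_le _ _ hC)
  obtain ⟨x, -, hx⟩ := (isCompact_Icc (a := -C) (b := C)).ultrafilter_le_nhds
    ((Ultrafilter.of atTop).map fun i => avg (W i) (g i) f)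
    (le_principal_iff.2 (Filter.mem_map.2 (Filter.univ_mem' hmem)))
  have hx' : Tendsto (fun i => avg (W i) (g i) f)
      ((Ultrafilter.of atTop : Ultrafilter (Finset G × ℕ)) : Filter (Finset G × ℕ)) (𝓝 x) := hx
  have h2 : m.toFun f = x := hx'.limUnder_eq
  rw [h2]
  exact ge_of_tendsto' hx' fun i => div_nonneg (hg i).le (Nat.cast_nonneg _)

end GroupMean

/-! ### Matching along a window -/

section Matching

variable {G : Type u} [Group G]

/-- If every right translate of the window `W` meets `H` in at least as many points as `L`, then
`L` can be matched into `H` at bounded distance. -/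
lemma exists_matching {W : Finset G} (hW : W.Nonempty) {L H : Set G}
    (h : ∀ g, (W.filter fun w => w * g ∈ L).card ≤ (W.filter fun w => w * g ∈ H).card) :
    ∃ φ : L → G, Function.Injective φ ∧ ∀ l, φ l ∈ H ∧ φ l * (l : G)⁻¹ ∈ W * W⁻¹ := by
  let t : L → Finset G := fun l =>
    ((W * W⁻¹).image fun d => d * (l : G)).filter fun x => x ∈ H
  have ht : ∀ {l : L} {x : G}, x ∈ t l ↔ x ∈ H ∧ x * (l : G)⁻¹ ∈ W * W⁻¹ := by
    intro l x
    simp only [t, Finset.mem_filter, Finset.mem_image]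
    constructor
    · rintro ⟨⟨d, hd, rfl⟩, hx⟩
      exact ⟨hx, by simpa using hd⟩
    · rintro ⟨hx, hd⟩
      exact ⟨⟨_, hd, by simp⟩, hx⟩
  -- Hall's condition for a finite `A ⊆ L` with neighbours `N` follows by counting pairs `(w, g)`
  -- with `wg` in `A` or in `N`. If `Wg` meets `A`, all its points of `H` lie in `N`, so the
  -- hypothesis compares the two counts for each `g`.
  obtain ⟨φ, hφ, hφt⟩ := (Finset.all_card_le_biUnion_card_iff_exists_injective t).1 fun s => by
    set A : Finset G := s.map (Function.Embedding.subtype _) with hA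
    set N := s.biUnion t with hN
    have hcard : A.card = s.card := Finset.card_map _
    set Γ : Finset G := W⁻¹ * A with hΓ
    have hAL : ∀ a ∈ A, ∃ h : a ∈ L, (⟨a, h⟩ : L) ∈ s := by
      intro a ha
      obtain ⟨l, hl, rfl⟩ := Finset.mem_map.1 ha
      exact ⟨l.2, hl⟩
    have e1 : ∀ w ∈ W, A.card ≤ (Γ.filter fun g => w * g ∈ A).card := by
      intro w hw
      refine Finset.card_le_card_of_injOn (fun a => w⁻¹ * a) (fun a ha => ?_)
        (fun a _ b _ hab => by simpa using hab)
      refine Finset.mem_coe.2 (Finset.mem_filter.2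
        ⟨Finset.mul_mem_mul (Finset.inv_mem_inv hw) ha, by simpa using ha⟩)
    have e2 : ∀ w ∈ W, (Γ.filter fun g => w * g ∈ N).card ≤ N.card := by
      intro w _
      exact Finset.card_le_card_of_injOn (fun g => w * g)
        (fun g hg => (Finset.mem_filter.1 hg).2) (fun a _ b _ hab => by simpa using hab)
    have e3 : ∀ g ∈ Γ, (W.filter fun w => w * g ∈ A).card ≤ (W.filter fun w => w * g ∈ N).card := by
      intro g hg
      obtain ⟨w', hw', a, ha, rfl⟩ := Finset.mem_mul.1 hg
      obtain ⟨haL, has⟩ := hAL a ha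
      refine (Finset.card_le_card ?_).trans ((h (w' * a)).trans (Finset.card_le_card ?_))
      · intro w hw
        obtain ⟨h1, h2⟩ := Finset.mem_filter.1 hw
        exact Finset.mem_filter.2 ⟨h1, (hAL _ h2).1⟩
      · intro w hw
        obtain ⟨h1, h2⟩ := Finset.mem_filter.1 hw
        refine Finset.mem_filter.2 ⟨h1, Finset.mem_biUnion.2 ⟨⟨a, haL⟩, has, ht.2 ⟨h2, ?_⟩⟩⟩
        simpa [← mul_assoc] using Finset.mul_mem_mul h1 hw'
    have e4 : W.card * A.card ≤ W.card * N.card := by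
      calc W.card * A.card ≤ ∑ w ∈ W, (Γ.filter fun g => w * g ∈ A).card := by
            rw [← smul_eq_mul, ← Finset.sum_const]
            exact Finset.sum_le_sum e1
        _ = ∑ g ∈ Γ, (W.filter fun w => w * g ∈ A).card := by
            simp only [Finset.card_filter]
            exact Finset.sum_comm
        _ ≤ ∑ g ∈ Γ, (W.filter fun w => w * g ∈ N).card := Finset.sum_le_sum e3
        _ = ∑ w ∈ W, (Γ.filter fun g => w * g ∈ N).card := by
            simp only [Finset.card_filter]
            exact Finset.sum_comm
        _ ≤ W.card * N.card := by
            rw [← smul_eq_mul, ← Finset.sum_const]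
            exact Finset.sum_le_sum e2
    rw [← hcard]
    exact Nat.le_of_mul_le_mul_left e4 hW.card_pos
  exact ⟨φ, hφ, fun l => ht.1 (hφt l)⟩

end Matching

/-! ### Existence of multi-tiles with small boundary -/

section Existence

variable {G : Type u} [Group G]

lemma boundary_image_mul_right (S P : Finset G) (a : G) :
    boundary S (P.image (· * a)) = (boundary S P).image (· * a) := by
  have hmem : ∀ y, y ∈ P.image (· * a) ↔ y * a⁻¹ ∈ P := by
    intro y
    rw [Finset.mem_image]
    exact ⟨by rintro ⟨x, hx, rfl⟩; simpa using hx, fun h => ⟨_, h, by simp⟩⟩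
  ext y
  simp only [boundary, Finset.mem_filter, hmem, Finset.mem_image]
  constructor
  · rintro ⟨h1, s, hs, h2⟩
    exact ⟨y * a⁻¹, ⟨h1, s, hs, by simpa [mul_assoc] using h2⟩, by simp⟩
  · rintro ⟨x, ⟨h1, s, hs, h2⟩, rfl⟩
    exact ⟨by simpa using h1, s, hs, by simpa [mul_assoc] using h2⟩

lemma boundaryRatio_image_mul_right (S P : Finset G) (a : G) :
    boundaryRatio S (P.image (· * a)) = boundaryRatio S P := by
  have hinj : Function.Injective (· * a) := mul_left_injective a
  rw [boundaryRatio, boundaryRatio, boundary_image_mul_right,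
    Finset.card_image_of_injective _ hinj, Finset.card_image_of_injective _ hinj]

/-- A set with empty boundary is stable under the generators, hence under `G`, and a finite nonempty
set cannot be. -/
lemma boundary_nonempty [Infinite G] {S : Finset G} (hS : IsSymmGenSet S) {P : Finset G}
    (hP : P.Nonempty) : (boundary S P).Nonempty := by
  by_contra hcon
  have hst : ∀ s ∈ S, ∀ x ∈ P, s * x ∈ P := by
    intro s hs x hx
    by_contra h
    exact hcon ⟨x, Finset.mem_filter.2 ⟨hx, s, hs, h⟩⟩
  have hall : ∀ g : G, ∀ x ∈ P, g * x ∈ P := by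
    intro g
    have hg : g ∈ Subgroup.closure (S : Set G) := by simp [hS.closure_eq_top]
    induction hg using Subgroup.closure_induction'' with
    | mem s hs => exact hst s hs
    | inv_mem s hs => exact hst _ (hS.inv_mem s hs)
    | one => simp
    | mul a b _ _ ha hb =>
      intro x hx
      rw [mul_assoc]
      exact ha _ (hb x hx)
  obtain ⟨p, hp⟩ := hP
  refine Set.infinite_univ (P.finite_toSet.subset fun g _ => ?_)
  simpa using hall (g * p⁻¹) p hp

/-- A partition of `G` into sets of bounded diameter and small boundary gives a multi-tile. -/
lemma exists_multiTile_of_map {S : Finset G} {r : ℝ} (hr : 0 ≤ r) (ρ : G → G) (D : Finset G)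
    (hD : ∀ x, x * (ρ x)⁻¹ ∈ D)
    (h : ∀ c (P : Finset G), (∀ x, x ∈ P ↔ ρ x = c) → P.Nonempty → boundaryRatio S P ≤ r) :
    ∃ T : MultiTile G, T.maxRatio S ≤ r := by
  let P : G → Finset G := fun c => (D.image (· * c)).filter fun x => ρ x = c
  have hP : ∀ c x, x ∈ P c ↔ ρ x = c := by
    intro c x
    simp only [P, Finset.mem_filter, Finset.mem_image, and_iff_right_iff_imp]
    rintro rfl
    exact ⟨_, hD x, by simp⟩
  let rep : G → G := fun c => if h : ∃ y, ρ y = c then h.choose else 1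
  have hrep : ∀ g, ρ (rep (ρ g)) = ρ g := by
    intro g
    have h : ∃ y, ρ y = ρ g := ⟨g, rfl⟩
    simp only [rep, dif_pos h]
    exact h.choose_spec
  let Q : G → Finset G := fun c => (P c).image (· * (rep c)⁻¹)
  have hQ : ∀ g x, x ∈ Q (ρ g) ↔ ρ (x * rep (ρ g)) = ρ g := by
    intro g x
    simp only [Q, Finset.mem_image, hP]
    exact ⟨by rintro ⟨y, hy, rfl⟩; simpa using hy, fun h => ⟨_, h, by simp⟩⟩
  -- A class translated so that its representative becomes `1` lies in `D * D⁻¹`, so only finitely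
  -- many shapes occur.
  let 𝒬 : Finset (Finset G) := (D * D⁻¹).powerset.filter fun q => 1 ∈ q ∧ boundaryRatio S q ≤ r
  have hQ𝒬 : ∀ g, Q (ρ g) ∈ 𝒬 := by
    intro g
    refine Finset.mem_filter.2 ⟨Finset.mem_powerset.2 fun x hx => ?_, ?_, ?_⟩
    · rw [hQ] at hx
      have h1 := hD (x * rep (ρ g))
      have h2 := Finset.inv_mem_inv (hD (rep (ρ g)))
      rw [hx] at h1
      rw [hrep] at h2
      have := Finset.mul_mem_mul h1 h2
      simpa [mul_assoc] using this
    · rw [hQ, one_mul, hrep]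
    · simp only [Q]
      rw [boundaryRatio_image_mul_right]
      exact h _ _ (hP _) ⟨g, (hP _ _).2 rfl⟩
  let e := 𝒬.equivFin
  refine ⟨⟨𝒬.card, fun i => (e.symm i : Finset G), fun i =>
    (Finset.mem_filter.1 (e.symm i).2).2.1, fun i => {c | ∃ g, c = rep (ρ g) ∧
      Q (ρ g) = (e.symm i : Finset G)}, fun g => ?_⟩, ?_⟩
  · refine ⟨(e ⟨Q (ρ g), hQ𝒬 g⟩, rep (ρ g)), ⟨⟨g, rfl, by simp⟩, g * (rep (ρ g))⁻¹, ?_, by simp⟩, ?_⟩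
    · simp [hQ]
    · rintro ⟨i, c⟩ ⟨⟨g', rfl, hi⟩, t, ht, hg⟩
      dsimp only at ht hg hi
      rw [← hi, hQ, ← hg] at ht
      refine Prod.ext ?_ (congrArg rep ht.symm)
      dsimp only
      rw [← e.symm_apply_eq]
      exact Subtype.ext (hi.symm.trans (congrArg Q ht.symm))
  · exact Real.iSup_le (fun i => (Finset.mem_filter.1 (e.symm i).2).2.2) hr

/-- Each bad point joins the good fibre of its match. A good fibre `P` gains at most `2η|P|` points,
and even if all of them are boundary points, the boundary has at most `3η|P|` elements. The finite
set `E` keeps the new classes of bounded diameter. -/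
lemma exists_multiTile_of_label_of_matching {S : Finset G} {η : ℝ} (hη : 0 < η)
    {ρ : G → G} {P Hs : G → Finset G} (hP : ∀ c x, x ∈ P c ↔ ρ x = c) {D : Finset G}
    (hD : ∀ x, x * (ρ x)⁻¹ ∈ D) (hHs : ∀ c, ((Hs c).card : ℝ) ≤ 2 * η * (P c).card) {E : Finset G}
    {Good : G → Prop} (hGood : ∀ c, Good c → ((boundary S (P c)).card : ℝ) ≤ η * (P c).card)
    (φ : {x | ¬ Good (ρ x)} → G) (hφ : Function.Injective φ)
    (hφH : ∀ l, φ l ∈ Hs (ρ (φ l)) ∧ Good (ρ (φ l))) (hφE : ∀ l, φ l * (l : G)⁻¹ ∈ E) :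
    ∃ T : MultiTile G, T.maxRatio S ≤ 3 * η := by
  let ρ' : G → G := fun x => if h : Good (ρ x) then ρ x else ρ (φ ⟨x, h⟩)
  have hgood : ∀ x, Good (ρ x) → ρ' x = ρ x := fun x h => by simp [ρ', h]
  have hbad : ∀ x (h : ¬ Good (ρ x)), ρ' x = ρ (φ ⟨x, h⟩) := fun x h => by simp [ρ', h]
  refine exists_multiTile_of_map (by positivity) ρ' (D ∪ E⁻¹ * D) (fun x => ?_)
    fun c P' hP' hne => ?_
  · by_cases h : Good (ρ x)
    · rw [hgood x h]
      exact Finset.mem_union_left _ (hD x)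
    · rw [hbad x h]
      refine Finset.mem_union_right _ ?_
      have h1 := Finset.mul_mem_mul (Finset.inv_mem_inv (hφE ⟨x, h⟩)) (hD (φ ⟨x, h⟩))
      simpa [mul_assoc] using h1
  · have hc : Good c := by
      obtain ⟨x, hx⟩ := hne
      rw [hP'] at hx
      by_cases h : Good (ρ x)
      · rwa [← hx, hgood x h]
      · rw [← hx, hbad x h]
        exact (hφH _).2
    have hsub : P c ⊆ P' := by
      intro x hx
      rw [hP] at hx
      subst hx
      rw [hP', hgood x hc]
    have hL : ∀ x ∈ P' \ P c, ∃ h : ¬ Good (ρ x), φ ⟨x, h⟩ ∈ Hs c := by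
      intro x hx
      rw [Finset.mem_sdiff, hP', hP] at hx
      have h : ¬ Good (ρ x) := fun h => hx.2 (by rw [← hx.1, hgood x h])
      refine ⟨h, ?_⟩
      have h1 := (hφH ⟨x, h⟩).1
      rwa [← hbad x h, hx.1] at h1
    have hcard : (P' \ P c).card ≤ (Hs c).card := by
      refine Finset.card_le_card_of_injOn
        (fun x => if h : ¬ Good (ρ x) then φ ⟨x, h⟩ else x) (fun x hx => ?_) ?_
      · obtain ⟨h, h'⟩ := hL x hx
        simpa [h] using h'
      · intro x hx y hy hxy
        obtain ⟨h, -⟩ := hL x hx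
        obtain ⟨h', -⟩ := hL y hy
        simp only [dif_pos h, dif_pos h'] at hxy
        exact congrArg Subtype.val (hφ hxy)
    have hbd : boundary S P' ⊆ boundary S (P c) ∪ (P' \ P c) := by
      intro x hx
      obtain ⟨h1, s, hs, h2⟩ := Finset.mem_filter.1 hx
      by_cases h : x ∈ P c
      · exact Finset.mem_union_left _ (Finset.mem_filter.2 ⟨h, s, hs, fun h' => h2 (hsub h')⟩)
      · exact Finset.mem_union_right _ (Finset.mem_sdiff.2 ⟨h1, h⟩)
    have h1 : ((boundary S P').card : ℝ) ≤ (boundary S (P c)).card + (Hs c).card := by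
      exact_mod_cast (Finset.card_le_card hbd).trans ((Finset.card_union_le _ _).trans
        (Nat.add_le_add_left hcard _))
    have h2 : ((P c).card : ℝ) ≤ P'.card := by exact_mod_cast Finset.card_le_card hsub
    have h0 : (0 : ℝ) < P'.card := by exact_mod_cast hne.card_pos
    rw [boundaryRatio, div_le_iff₀ h0]
    have h3 := hGood c hc
    have h4 := hHs c
    nlinarith

/-- An infinite amenable group has multi-tiles with arbitrarily small boundary ratio. -/
theorem exists_multiTile_le [Infinite G] (hG : IsAmenableGroup G) {S : Finset G}
    (hS : IsSymmGenSet S) {r : ℝ} (hr : 0 < r) : ∃ T : MultiTile G, T.maxRatio S ≤ r := by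
  have hcount := hS.countable
  let _ : MeasurableSpace G := ⊤
  have hsmul : MeasurableConstSMul G G := ⟨fun _ => .of_discrete⟩
  set η : ℝ := min (1 / 2) (r / 3) with hηdef
  have hη : 0 < η := by positivity
  have hη2 : η ≤ 1 / 2 := min_le_left _ _
  have hηr : 3 * η ≤ r := by linarith [min_le_right (1 / 2) (r / 3)]
  -- Bad fibres have boundary ratio above `η`, so the bound `η ^ 3` leaves bad points of mean at
  -- most `η ^ 2`. For `η ≤ 1 / 2` this is less than `η * (1 - η ^ 2)`, which bounds the mean of the
  -- reserve from below.
  obtain ⟨γ, F, hγ, hF, hm⟩ := exists_label (Z := G) hG S (show 0 < η ^ 3 by positivity)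
  set ρ := root γ with hρ
  let P : G → Finset G := fun c => (F.filter fun t => γ (t • c) = t).image (· * c)
  have hP : ∀ c x, x ∈ P c ↔ ρ x = c := by
    intro c x
    simp only [P, Finset.mem_image, Finset.mem_filter, hρ, root, smul_eq_mul]
    constructor
    · rintro ⟨t, ⟨-, h2⟩, rfl⟩
      simp [h2]
    · rintro rfl
      exact ⟨γ x, ⟨hF x, by simp⟩, by simp⟩
  have hsum : ∀ c (f : G → ℝ), ∑ t ∈ F with γ (t • c) = t, f (t • c) = ∑ x ∈ P c, f x := by
    intro c f
    rw [Finset.sum_image fun x _ y _ hxy => mul_left_injective c hxy]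
    rfl
  let Good : G → Prop := fun c => ((boundary S (P c)).card : ℝ) ≤ η * (P c).card
  have hHex : ∀ c, ∃ H ⊆ P c, H.card = ⌊2 * η * (P c).card⌋₊ := by
    intro c
    refine Finset.exists_subset_card_eq (Nat.floor_le_of_le ?_)
    have : (0 : ℝ) ≤ (P c).card := Nat.cast_nonneg _
    nlinarith
  choose Hs hHsub hHcard using hHex
  obtain ⟨L, hLdef⟩ : ∃ L : Set G, L = {x | ¬ Good (ρ x)} := ⟨_, rfl⟩
  obtain ⟨H, hHdef⟩ : ∃ H : Set G, H = {x | x ∈ Hs (ρ x) ∧ Good (ρ x)} := ⟨_, rfl⟩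
  obtain ⟨B, hBdef⟩ : ∃ B : Set G, B = {x | ∃ s ∈ S, ρ (s • x) ≠ ρ x} := ⟨_, rfl⟩
  have hLm : ∀ x, x ∈ L ↔ ¬ Good (ρ x) := fun x => by rw [hLdef]; rfl
  have hHm : ∀ x, x ∈ H ↔ x ∈ Hs (ρ x) ∧ Good (ρ x) := fun x => by rw [hHdef]; rfl
  have hBm : ∀ x, x ∈ B ↔ ∃ s ∈ S, ρ (s • x) ≠ ρ x := fun x => by rw [hBdef]; rfl
  have hmeas : ∀ A : Set G, MeasurableSet A := fun A => .of_discrete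
  have hBd : ∀ c, (P c).filter (fun x => x ∈ B) = boundary S (P c) := by
    intro c
    ext x
    simp only [Finset.mem_filter, boundary, hP, hBm, and_congr_right_iff]
    rintro rfl
    rfl
  have hL : ∀ m : InvMean G G, η * m.set L ≤ η ^ 3 := by
    intro m
    refine le_trans ?_ (hm m)
    rw [← hBdef]
    have h1 := m.le_of_fiberwise hγ hF ((IsBddMeas.indicator (hmeas L)).const_mul η)
      (.indicator (hmeas B)) (fun c => by
        rw [hsum c (fun x => η * if x ∈ L then 1 else 0), hsum c (fun x => if x ∈ B then 1 else 0),
          Finset.sum_boole, hBd, ← Finset.mul_sum, Finset.sum_boole]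
        by_cases hc : Good c
        · have : (P c).filter (fun x => x ∈ L) = ∅ := by
            refine Finset.filter_eq_empty_iff.2 fun x hx hxL => (hLm x).1 hxL ?_
            rwa [(hP c x).1 hx]
          rw [this]
          simp
        · refine le_trans ?_ (not_le.1 hc).le
          gcongr
          exact Finset.filter_subset _ _)
    rwa [m.map_mul _ _ (.indicator (hmeas L))] at h1
  have hH : ∀ m : InvMean G G, η * (1 - m.set L) ≤ m.set H := by
    intro m
    obtain ⟨M, hM⟩ : ∃ M : Set G, M = Lᶜ := ⟨_, rfl⟩
    have h1 := m.le_of_fiberwise hγ hF ((IsBddMeas.indicator (hmeas M)).const_mul η)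
      (.indicator (hmeas H)) (fun c => by
        rw [hsum c (fun x => η * if x ∈ M then 1 else 0), hsum c (fun x => if x ∈ H then 1 else 0),
          Finset.sum_boole, ← Finset.mul_sum, Finset.sum_boole]
        by_cases hc : Good c
        · rcases (P c).eq_empty_or_nonempty with he | hne
          · simp [he]
          have h2 : (P c).filter (fun x => x ∈ H) = Hs c := by
            ext x
            simp only [Finset.mem_filter, hHm]
            constructor
            · rintro ⟨h3, h4, -⟩
              rwa [(hP c x).1 h3] at h4
            · intro h3
              have h4 := hHsub c h3
              refine ⟨h4, ?_⟩
              rw [(hP c x).1 h4]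
              exact ⟨h3, hc⟩
          rw [h2, hHcard]
          -- The boundary has a point because `G` is infinite, so `η|P| ≥ 1` in a good fibre and
          -- rounding `2η|P|` down still leaves `η|P|`.
          have h5 : (1 : ℝ) ≤ (boundary S (P c)).card := by
            exact_mod_cast (boundary_nonempty hS hne).card_pos
          have h6 : (1 : ℝ) ≤ η * (P c).card := h5.trans hc
          have h7 := Nat.lt_floor_add_one (2 * η * (P c).card)
          have h8 : η * (((P c).filter fun x => x ∈ M).card : ℝ) ≤ η * (P c).card := by
            gcongr
            exact Finset.filter_subset _ _
          linarith
        · have : (P c).filter (fun x => x ∈ M) = ∅ := by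
            refine Finset.filter_eq_empty_iff.2 fun x hx hxM => ?_
            rw [hM] at hxM
            refine hxM ?_
            rwa [hLm, (hP c x).1 hx]
          rw [this]
          simp)
    rw [m.map_mul _ _ (.indicator (hmeas M))] at h1
    have h2 := m.set_diff (hmeas Set.univ) (hmeas L) (Set.subset_univ L)
    rw [m.set_univ, ← Set.compl_eq_univ_sdiff, ← hM] at h2
    rw [← h2]
    exact h1
  obtain ⟨W, hW, hWs⟩ := exists_window (f := fun x => (if x ∈ L then (1 : ℝ) else 0) +
      (-1) * if x ∈ H then (1 : ℝ) else 0) hG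
      ((IsBddMeas.indicator (hmeas L)).add ((IsBddMeas.indicator (hmeas H)).const_mul (-1)))
      (fun m => by
        rw [m.map_add _ _ (.indicator (hmeas L)) ((IsBddMeas.indicator (hmeas H)).const_mul (-1)),
          m.map_mul _ _ (.indicator (hmeas H))]
        change m.set L + -1 * m.set H < 0
        have h1 := hL m
        have h2 := hH m
        have h3 : m.set L ≤ η ^ 2 := by
          refine le_of_mul_le_mul_left (h1.trans_eq ?_) hη
          ring
        have h4 : η ^ 2 ≤ η / 2 := by nlinarith
        nlinarith)
  obtain ⟨φ, hφ, hφH⟩ := exists_matching (L := L) (H := H) hW fun g => by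
    have h1 := hWs g
    rw [Finset.sum_add_distrib, ← Finset.mul_sum, Finset.sum_boole, Finset.sum_boole] at h1
    have h2 : (((W.filter fun w => w * g ∈ L).card : ℕ) : ℝ) ≤
      ((W.filter fun w => w * g ∈ H).card : ℕ) := by linarith
    exact_mod_cast h2
  subst hLdef
  obtain ⟨T, hT⟩ := exists_multiTile_of_label_of_matching (S := S) hη hP (D := F) (Hs := Hs)
    (Good := Good) (fun x => by simpa [hρ, root] using hF x)
    (fun c => by rw [hHcard]; exact Nat.floor_le (by positivity)) (fun c hc => hc) φ hφ
    (fun l => (hHm _).1 (hφH l).1) (fun l => (hφH l).2)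
  exact ⟨T, hT.trans hηr⟩

/-- The multi-tile with the single shape `{1}`. -/
def trivialTile (G : Type u) [Group G] : MultiTile G where
  N := 1
  shape _ := {1}
  one_mem _ := by simp
  exists_centers := ⟨fun _ => Set.univ, fun g => ⟨(0, g), by simp, by
    rintro ⟨i, c⟩ ⟨-, t, ht, rfl⟩
    have : t = 1 := by simpa using ht
    simp [this, Subsingleton.elim i 0]⟩⟩

/-- Multi-tiles with at most `n` elements per shape and vanishing boundary ratio. -/
theorem exists_seq_multiTile [Infinite G] (hG : IsAmenableGroup G) {S : Finset G}
    (hS : IsSymmGenSet S) :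
    ∃ T : ℕ → MultiTile G, (∀ n : ℕ, 1 ≤ n → (T n).SizeLE n) ∧
      Tendsto (fun n => (T n).maxRatio S) atTop (𝓝 0) := by
  -- Nearly optimal multi-tiles are chosen for each size bound. A fixed multi-tile is admissible for
  -- all large `n`, so the infima tend to zero by `exists_multiTile_le`.
  let R : ℕ → Set ℝ := fun n => {r | ∃ T : MultiTile G, T.SizeLE n ∧ r = T.maxRatio S}
  have hbdd : ∀ n, BddBelow (R n) := fun n =>
    ⟨0, by rintro r ⟨T, -, rfl⟩; exact T.maxRatio_nonneg S⟩
  have hex : ∀ n : ℕ, ∃ T : MultiTile G, (1 ≤ n → T.SizeLE n) ∧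
      (1 ≤ n → T.maxRatio S < sInf (R n) + 1 / ((n : ℝ) + 1)) := by
    intro n
    by_cases hn : 1 ≤ n
    · have hne : (R n).Nonempty := ⟨_, trivialTile G, fun _ => by simpa [trivialTile] using hn, rfl⟩
      obtain ⟨r, ⟨T, hT, rfl⟩, hr⟩ := exists_lt_of_csInf_lt hne
        (show sInf (R n) < sInf (R n) + 1 / ((n : ℝ) + 1) by
          have : 0 < 1 / ((n : ℝ) + 1) := by positivity
          linarith)
      exact ⟨T, fun _ => hT, fun _ => hr⟩
    · exact ⟨trivialTile G, fun h => absurd h hn, fun h => absurd h hn⟩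
  choose T hT hTr using hex
  refine ⟨T, hT, ?_⟩
  rw [Metric.tendsto_atTop]
  intro ε hε
  obtain ⟨T', hT'⟩ := exists_multiTile_le hG hS (half_pos hε)
  obtain ⟨k, hk⟩ := exists_nat_one_div_lt (half_pos hε)
  refine ⟨max (max 1 k) (∑ i, (T'.shape i).card), fun n hn => ?_⟩
  have h1 : 1 ≤ n := (le_max_left _ _).trans ((le_max_left _ _).trans hn)
  have h2 : k ≤ n := (le_max_right _ _).trans ((le_max_left _ _).trans hn)
  have h3 : T'.SizeLE n := fun i =>
    (Finset.single_le_sum (f := fun i => (T'.shape i).card) (fun _ _ => Nat.zero_le _)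
      (Finset.mem_univ i)).trans ((le_max_right _ _).trans hn)
  have h4 : sInf (R n) ≤ ε / 2 := (csInf_le (hbdd n) ⟨T', h3, rfl⟩).trans hT'
  have h5 := hTr n h1
  have h6 : 1 / ((n : ℝ) + 1) ≤ 1 / ((k : ℝ) + 1) := by gcongr
  rw [Real.dist_eq, sub_zero, abs_of_nonneg ((T n).maxRatio_nonneg S)]
  linarith

end Existence

end IsoProfile

end

theorem theorem1p4 {G : Type u} [Group G] (hG : IsoProfile.IsAmenableGroup G)
    (S : Finset G) (hS : IsoProfile.IsSymmGenSet S) :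
    -- existence of multi-tiles with small shapes and vanishing boundary ratio
    (Infinite G → ∃ T : ℕ → IsoProfile.MultiTile G,
        (∀ n : ℕ, 1 ≤ n → (T n).SizeLE n) ∧
        Tendsto (fun n => (T n).maxRatio S) atTop (𝓝 0)) ∧
    ∀ (X : Type v) [MeasurableSpace X] [StandardBorelSpace X] [MulAction G X]
      (μ : Measure X) [IsProbabilityMeasure μ], IsoProfile.IsEssFreePMP G μ →
      -- the upper bound, for every multi-tile
      (∀ (n : ℕ) (T : IsoProfile.MultiTile G), T.SizeLE n →
        IsoProfile.actionProfile S μ n ≤ T.maxRatio S) ∧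
      -- optimal multi-tiles: asymptotic in the sense that the quotient tends to one, and in the
      -- sense of equality up to multiplicative constants
      (∀ T : ℕ → IsoProfile.MultiTile G, (∀ n : ℕ, 1 ≤ n → (T n).SizeLE n) →
        ((fun n => (T n).maxRatio S) ~[atTop] IsoProfile.groupProfile S →
          IsoProfile.actionProfile S μ ~[atTop] IsoProfile.groupProfile S) ∧
        ((fun n => (T n).maxRatio S) =Θ[atTop] IsoProfile.groupProfile S →
          IsoProfile.actionProfile S μ =Θ[atTop] IsoProfile.groupProfile S)) := by
  have hcount := hS.countable
  refine ⟨fun _ => IsoProfile.exists_seq_multiTile hG hS, ?_⟩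
  intro X _ _ _ μ _ hμ
  refine ⟨fun n T hT => IsoProfile.actionProfile_le_maxRatio hG S hμ hT, fun T hT => ?_⟩
  have hlow : ∀ᶠ n in atTop, IsoProfile.groupProfile S n ≤ IsoProfile.actionProfile S μ n := by
    filter_upwards [eventually_ge_atTop 1] with n hn
    exact IsoProfile.groupProfile_le_actionProfile S hμ hn
  have hup : ∀ᶠ n in atTop, IsoProfile.actionProfile S μ n ≤ (T n).maxRatio S := by
    filter_upwards [eventually_ge_atTop 1] with n hn
    exact IsoProfile.actionProfile_le_maxRatio hG S hμ (hT n hn)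
  exact ⟨fun h => IsoProfile.isEquivalent_of_squeeze hlow hup h,
    fun h => IsoProfile.isTheta_of_squeeze (IsoProfile.groupProfile_nonneg S) hlow hup h⟩
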